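/- **Setting.** Let $p,k,z\ge 0$ be integers with $k,z\le p$, $q=p-k$, $b=p-z$. Let $S\in\mathbb R^{p\times p}$, $\alpha\in\mathbb R$, $K=S+\alpha(2I-\mathbf 1\mathbf 1^T)$, $\beta,\gamma>0$, $0<c_1\le c_2$. For $w\in\mathbb R^{p(p-1)/2}$, indexed by the pairs $\{i,j\}$ of distinct vertices, let $\mathcal A w$ be the symmetric matrix with zero diagonal and off-diagonal entries $w_{ij}$, let $\mathcal L w=\mathrm{Diag}((\mathcal A w)\mathbf 1)-\mathcal A w$, and let $\mathcal L^*,\mathcal A^*$ be the adjoint operators, $[\mathcal L^*Y]_{ij}=y_{ii}-y_{ij}-y_{ji}+y_{jj}$, $[\mathcal A^*Y]_{ij}=y_{ij}+y_{ji}$. Let $\mathcal S_\lambda=\{\lambda\in\mathbb R^q: c_1\le\lambda_1\le\dots\le\lambda_q\le c_2\}$ and let $\mathcal S_\psi\subseteq\mathbb R^b$ be a closed convex set. For $\psi\in\mathbb R^b$ let $\hat\psi\in\mathbb R^p$ be $\psi$ with $z$ zeros inserted after the first $\lfloor b/2\rfloor$ entries. Assume that whenever $\psi$ is the point of $\mathcal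 S_\psi$ nearest to a nonincreasing $e\in\mathbb R^b$, the vector $\hat\psi$ is nonincreasing. (This holds, for even $b$, for $\mathcal S_\psi=\{\psi_i=-\psi_{b+1-i},\ C\ge\psi_1\ge\dots\ge\psi_{b/2}\ge c\}$ with $C\ge c>0$, and for $\mathcal S_\psi=\{\psi_i=-\psi_{b+1-i}\}$.) **Relaxed problem.** Minimize over $(w,U,\lambda,V,\psi)$ $$F=-\log\det\mathrm{Diag}(\lambda)+\mathrm{tr}(K\mathcal Lw)+\tfrac\beta2\|\mathcal Lw-U\mathrm{Diag}(\lambda)U^T\|_F^2+\tfrac\gamma2\|\mathcal Aw-V\mathrm{Diag}(\psi)V^T\|_F^2$$ subject to $w\ge0$, $\lambda\in\mathcal S_\lambda$, $U\in\mathbb R^{p\times q}$, $U^TU=I_q$, $\psi\in\mathcal S_\psi$, $V\in\mathbb R^{p\times b}$, $V^TV=I_b$. **Algorithm (SGLA).** From an arbitrary starting point, iteration $t\mapsto t+1$ is: 1. $w^{t+1}=\big[w^t-\frac1{2(p\beta+\gamma)}g^t\big]^+$, where $g^t=\beta\mathcal L^*(\mathcal Lw^t-U^t\mathrm{Diag}(\lambda^t)U^{tT})+\mathcal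 L^*K+\gamma\mathcal A^*(\mathcal Aw^t-V^t\mathrm{Diag}(\psi^t)V^{tT})$. 2. The columns of $U^{t+1}$ are members $k+1,\dots,p$ of an orthonormal eigenbasis of $\mathcal Lw^{t+1}$ listed by nondecreasing eigenvalue. 3. The columns of $V^{t+1}$ are what remains of an orthonormal eigenbasis of $\mathcal Aw^{t+1}$, listed by nonincreasing eigenvalue, when the $z$ members that follow the first $\lfloor b/2\rfloor$ are dropped. 4. $\lambda^{t+1}$ is returned by the following procedure with $d=\mathrm{diag}(U^{(t+1)T}\mathcal Lw^{t+1}U^{t+1})$ and $\varphi(u)=(u+\sqrt{u^2+4/\beta})/2$. Start with $\lambda_i=\varphi(d_i)$. While $\lambda\notin\mathcal S_\lambda$, carry out in order: (i) if $c_1\ge\lambda_1\ge\dots\ge\lambda_r$ with a strict inequality for some $r$, set $\lambda_1,\dots,\lambda_r$ to $c_1$, for the largest such $r$; (ii) if $\lambda_s\ge\dots\ge\lambda_q\ge c_2$ with a strict inequality for some $s$, set $\lambda_s,\dots,\lambda_q$ to $c_2$, for the smallest such $s$; (iii) if $\lambda_i\ge\dots\ge\lambda_m$ with a strict inequality for some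 $i\le m$, take such a run that cannot be enlarged and set $\lambda_i,\dots,\lambda_m$ to $\varphi\big(\frac1{m-i+1}\sum_{j=i}^m d_j\big)$. 5. $\psi^{t+1}$ minimizes $\|\psi-e\|_2^2$ over $\mathcal S_\psi$, where $e=\mathrm{diag}(V^{(t+1)T}\mathcal Aw^{t+1}V^{t+1})$. **Notions.** A feasible point is *stationary* if the directional derivative of $F$ exists and is nonnegative along every direction of the Bouligand tangent cone of the feasible set at that point. A feasible point is a *KKT point* if there are $\mu\ge0$, $\eta\in\mathbb R^{q+1}_{\ge0}$, matrices $M,N$ and $\nu$ in the normal cone of $\mathcal S_\psi$ at $\psi$, with $\mu_{ij}w_{ij}=0$ for all pairs and $\eta_ih_i(\lambda)=0$ for all $i$, such that all directional derivatives at the point of the Lagrangian $$F-\mu^Tw+\eta^Th(\lambda)+\mathrm{tr}(M^T(U^TU-I))+\mathrm{tr}(N^T(V^TV-I))+\nu^T\psi$$ vanish, where $h(\lambda)=(c_1-\lambda_1,\lambda_1-\lambda_2,\dots,\lambda_{q-1}-\lambda_q,\lambda_q-c_2)$ (and $h=c_1-c_2$ if $q=0$). **Theorem.** Let $x^t=(w^t,U^t,\lambda^t,V^t,\psi^t)$,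 $t\ge0$, be any sequence generated by the SGLA algorithm. Then: (a) the sequence stays in a compact set; (b) every limit point of the sequence is a stationary point and a KKT point of the relaxed problem; moreover, for every description $\mathcal S_\psi=\{\psi: a_j^T\psi\le r_j,\ j=1,\dots,s\}$ by finitely many affine inequalities, the multiplier $\nu$ can be taken of the form $\sum_j\rho_ja_j$ with $\rho_j\ge0$ and $\rho_j(a_j^T\psi-r_j)=0$; (c) the sequence converges to the set of KKT points, that is, every open set containing all KKT points contains $x^t$ for all large $t$. -/

import Mathlib

open Matrix Filter Topology

noncomputable section

namespace SGLA

/-! ### Graph weights and graph operators -/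

/-- Unordered pairs of distinct vertices of `{0, …, p-1}`, represented by `(i, j)` with `j < i`;
there are `p (p - 1) / 2` of them, and a weight vector `w ∈ ℝ^{p(p-1)/2}` is a function on them
(the column-by-column numbering of the strictly lower triangle plays no role). -/
abbrev Edge (p : ℕ) : Type := {e : Fin p × Fin p // e.2 < e.1}

/-- The weight of the pair `{i, j}`, and `0` when `i = j`. -/
def weight {p : ℕ} (w : Edge p → ℝ) (i j : Fin p) : ℝ :=
  if h : j < i then w ⟨(i, j), h⟩ else if h : i < j then w ⟨(j, i), h⟩ else 0

/-- The adjacency operator `𝒜`. -/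
def adjOp {p : ℕ} (w : Edge p → ℝ) : Matrix (Fin p) (Fin p) ℝ :=
  Matrix.of fun i j => weight w i j

/-- The Laplacian operator `ℒ`. -/
def lapOp {p : ℕ} (w : Edge p → ℝ) : Matrix (Fin p) (Fin p) ℝ :=
  Matrix.of fun i j => if i = j then ∑ l, weight w i l else -weight w i j

/-- The adjoint `ℒ*`. -/
def lapAdj {p : ℕ} (Y : Matrix (Fin p) (Fin p) ℝ) : Edge p → ℝ :=
  fun e => Y e.1.1 e.1.1 - Y e.1.1 e.1.2 - Y e.1.2 e.1.1 + Y e.1.2 e.1.2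

/-- The adjoint `𝒜*`. -/
def adjAdj {p : ℕ} (Y : Matrix (Fin p) (Fin p) ℝ) : Edge p → ℝ :=
  fun e => Y e.1.1 e.1.2 + Y e.1.2 e.1.1

/-- The squared Frobenius norm. -/
def frobSq {m n : ℕ} (M : Matrix (Fin m) (Fin n) ℝ) : ℝ := ∑ i, ∑ j, M i j ^ 2

/-! ### The relaxed problem -/

/-- The data of the problem on `p` vertices: `k` zero Laplacian eigenvalues and `z` zero adjacency
eigenvalues are dropped. `S` is the data matrix, `α` the sparsity parameter, `β, γ` the penalty
parameters, `c₁, c₂` the bounds for the nonzero Laplacian eigenvalues, and `Sψ` the constraint set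
for the vector of the remaining adjacency eigenvalues. -/
structure Problem (p k z : ℕ) where
  S : Matrix (Fin p) (Fin p) ℝ
  α : ℝ
  β : ℝ
  γ : ℝ
  c₁ : ℝ
  c₂ : ℝ
  Sψ : Set (Fin (p - z) → ℝ)

/-- The variable `(w, U, λ, V, ψ)`, with the product topology and vector space structure. -/
abbrev Var (p k z : ℕ) : Type :=
  (Edge p → ℝ) × Matrix (Fin p) (Fin (p - k)) ℝ × (Fin (p - k) → ℝ) ×
    Matrix (Fin p) (Fin (p - z)) ℝ × (Fin (p - z) → ℝ)

section Blocks

variable {p k z : ℕ}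

abbrev Var.w (x : Var p k z) : Edge p → ℝ := x.1

abbrev Var.U (x : Var p k z) : Matrix (Fin p) (Fin (p - k)) ℝ := x.2.1

abbrev Var.lam (x : Var p k z) : Fin (p - k) → ℝ := x.2.2.1

abbrev Var.V (x : Var p k z) : Matrix (Fin p) (Fin (p - z)) ℝ := x.2.2.2.1

abbrev Var.psi (x : Var p k z) : Fin (p - z) → ℝ := x.2.2.2.2

/-- `K = S + α (2 I - 1 1ᵀ)`. -/
def Problem.K (P : Problem p k z) : Matrix (Fin p) (Fin p) ℝ :=
  P.S + P.α • ((2 : ℝ) • (1 : Matrix (Fin p) (Fin p) ℝ) - Matrix.of fun _ _ => 1)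

/-- The ordered box `{c₁ ≤ λ₁ ≤ ⋯ ≤ λ_q ≤ c₂}`. -/
def Slam {q : ℕ} (c₁ c₂ : ℝ) : Set (Fin q → ℝ) :=
  {l | Monotone l ∧ ∀ i, c₁ ≤ l i ∧ l i ≤ c₂}

/-- The objective function of the relaxed problem. -/
def Problem.cost (P : Problem p k z) (x : Var p k z) : ℝ :=
  -Real.log (Matrix.diagonal x.lam).det + (P.K * lapOp x.w).trace
    + P.β / 2 * frobSq (lapOp x.w - x.U * Matrix.diagonal x.lam * x.Uᵀ)
    + P.γ / 2 * frobSq (adjOp x.w - x.V * Matrix.diagonal x.psi * x.Vᵀ)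

/-- The feasible set of the relaxed problem. -/
def Problem.feasible (P : Problem p k z) : Set (Var p k z) :=
  {x | (∀ e, 0 ≤ x.w e) ∧ x.Uᵀ * x.U = 1 ∧ x.lam ∈ Slam P.c₁ P.c₂ ∧
    x.Vᵀ * x.V = 1 ∧ x.psi ∈ P.Sψ}

/-! ### Stationary points and KKT points -/

/-- First-order stationarity: the directional derivative of the objective exists and is nonnegative
along every direction of the (Bouligand) tangent cone of the feasible set. -/
def Problem.IsStationary (P : Problem p k z) (x : Var p k z) : Prop :=
  x ∈ P.feasible ∧ ∀ d ∈ posTangentConeAt P.feasible x,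
    ∃ D : ℝ, HasLineDerivAt ℝ P.cost D x d ∧ 0 ≤ D

/-- The constraint functions `c₁ - λ₁, λ₁ - λ₂, …, λ_{q-1} - λ_q, λ_q - c₂` of the set
`{c₁ ≤ λ₁ ≤ ⋯ ≤ λ_q ≤ c₂}`. -/
def chainConstr {q : ℕ} (c₁ c₂ : ℝ) (l : Fin q → ℝ) (i : Fin (q + 1)) : ℝ :=
  (Fin.cons c₁ l : Fin (q + 1) → ℝ) i - (Fin.snoc l c₂ : Fin (q + 1) → ℝ) i

/-- The Lagrangian, with multipliers `μ` for `w ≥ 0`, `η` for the constraints on `λ`, `M` and `N`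
for `UᵀU = I` and `VᵀV = I`, and `ν` for `ψ ∈ Sψ`. -/
def Problem.lagrangian (P : Problem p k z) (μ : Edge p → ℝ) (η : Fin (p - k + 1) → ℝ)
    (M : Matrix (Fin (p - k)) (Fin (p - k)) ℝ) (N : Matrix (Fin (p - z)) (Fin (p - z)) ℝ)
    (ν : Fin (p - z) → ℝ) (x : Var p k z) : ℝ :=
  P.cost x - μ ⬝ᵥ x.w + η ⬝ᵥ chainConstr P.c₁ P.c₂ x.lam
    + (Mᵀ * (x.Uᵀ * x.U - 1)).trace + (Nᵀ * (x.Vᵀ * x.V - 1)).trace + ν ⬝ᵥ x.psi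

/-- The KKT conditions, where `NC` is the set of admissible multipliers `ν` for `ψ ∈ Sψ`. -/
def Problem.IsKKTWith (P : Problem p k z) (NC : Set (Fin (p - z) → ℝ)) (x : Var p k z) : Prop :=
  x ∈ P.feasible ∧
  ∃ (μ : Edge p → ℝ) (η : Fin (p - k + 1) → ℝ) (M : Matrix (Fin (p - k)) (Fin (p - k)) ℝ)
    (N : Matrix (Fin (p - z)) (Fin (p - z)) ℝ) (ν : Fin (p - z) → ℝ),
    (∀ e, 0 ≤ μ e) ∧ (∀ e, μ e * x.w e = 0) ∧
    (∀ i, 0 ≤ η i) ∧ (∀ i, η i * chainConstr P.c₁ P.c₂ x.lam i = 0) ∧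
    ν ∈ NC ∧
    ∀ d : Var p k z, HasLineDerivAt ℝ (P.lagrangian μ η M N ν) 0 x d

/-- The normal cone of a convex set `C` at `y`. -/
def normalCone {n : ℕ} (C : Set (Fin n → ℝ)) (y : Fin n → ℝ) : Set (Fin n → ℝ) :=
  {ν | ∀ y' ∈ C, ν ⬝ᵥ (y' - y) ≤ 0}

/-- KKT points of the relaxed problem, for an arbitrary convex constraint set `Sψ`. -/
def Problem.IsKKT (P : Problem p k z) (x : Var p k z) : Prop :=
  P.IsKKTWith (normalCone P.Sψ x.psi) x

/-- The combinations `∑ⱼ ρⱼ aⱼ` whose multipliers satisfy `ρ ≥ 0` and complementary slackness at `y`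
for the constraints `⟨aⱼ, y⟩ ≤ rⱼ`. -/
def multiplierCone {n s : ℕ} (a : Fin s → Fin n → ℝ) (r : Fin s → ℝ) (y : Fin n → ℝ) :
    Set (Fin n → ℝ) :=
  {ν | ∃ ρ : Fin s → ℝ, (∀ j, 0 ≤ ρ j) ∧ (∀ j, ρ j * (a j ⬝ᵥ y - r j) = 0) ∧
    ν = ∑ j, ρ j • a j}

/-! ### The algorithm -/

/-- `X` consists of the columns `idx 0, idx 1, …` of an orthonormal eigenbasis of `A` whose
eigenvalues are listed as `d`. -/
def IsEigenvectors {n : ℕ} (A : Matrix (Fin p) (Fin p) ℝ) (d : Fin p → ℝ)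
    (idx : Fin n → Fin p) (X : Matrix (Fin p) (Fin n) ℝ) : Prop :=
  ∃ Q : Matrix (Fin p) (Fin p) ℝ, Qᵀ * Q = 1 ∧ A * Q = Q * Matrix.diagonal d ∧
    X = Q.submatrix id idx

/-- The positions `[k+1 : p]`. -/
def idxU (p k : ℕ) (i : Fin (p - k)) : Fin p := ⟨i.1 + k, by omega⟩

/-- The positions `[1 : (p-z)/2, (p+z)/2+1 : p]`. -/
def idxV (p z : ℕ) (i : Fin (p - z)) : Fin p :=
  if i.1 < (p - z) / 2 then ⟨i.1, by omega⟩ else ⟨i.1 + z, by omega⟩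

/-- The vector of `ℝᵖ` obtained from `ψ` by putting the `z` dropped zeros back in the middle. -/
def padZeros (p z : ℕ) (ψ : Fin (p - z) → ℝ) (j : Fin p) : ℝ :=
  ∑ i, if idxV p z i = j then ψ i else 0

/-- The gradient in `w` of the two penalty terms plus the linear term: `∇f₁ + ∇f₂`. -/
def Problem.gradW (P : Problem p k z) (x : Var p k z) : Edge p → ℝ :=
  (P.β • lapAdj (lapOp x.w)
      - P.β • lapAdj (x.U * Matrix.diagonal x.lam * x.Uᵀ - P.β⁻¹ • P.K))
    + (P.γ • adjAdj (adjOp x.w)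
      - P.γ • adjAdj (x.V * Matrix.diagonal x.psi * x.Vᵀ))

/-- The `w`-update, with `L₁ + L₂ = 2 p β + 2 γ`. -/
def Problem.updateW (P : Problem p k z) (x : Var p k z) : Edge p → ℝ :=
  fun e => max (x.w e - 1 / (2 * p * P.β + 2 * P.γ) * P.gradW x e) 0

/-- `(d + √(d² + 4/β)) / 2`. -/
def phi (β d : ℝ) : ℝ := (d + √(d ^ 2 + 4 / β)) / 2

/-- `c₁ ≥ λ₁ ≥ ⋯ ≥ λ_r` with at least one strict inequality. -/
def Sit1 {q : ℕ} (c₁ : ℝ) (l : Fin q → ℝ) (r : Fin q) : Prop :=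
  (∀ i ≤ r, l i ≤ c₁) ∧ AntitoneOn l (Set.Iic r) ∧ l r < c₁

/-- `λ_s ≥ ⋯ ≥ λ_q ≥ c₂` with at least one strict inequality. -/
def Sit2 {q : ℕ} (c₂ : ℝ) (l : Fin q → ℝ) (s : Fin q) : Prop :=
  (∀ i ≥ s, c₂ ≤ l i) ∧ AntitoneOn l (Set.Ici s) ∧ c₂ < l s

/-- `λ_i ≥ ⋯ ≥ λ_m` with at least one strict inequality. -/
def Sit3 {q : ℕ} (l : Fin q → ℝ) (i m : Fin q) : Prop :=
  i ≤ m ∧ AntitoneOn l (Set.Icc i m) ∧ l m < l i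

open Classical in
/-- Check of situation 1, applied to the longest run. -/
def Step1 {q : ℕ} (c₁ : ℝ) (l l' : Fin q → ℝ) : Prop :=
  (∃ r, IsGreatest {r | Sit1 c₁ l r} r ∧ l' = fun j => if j ≤ r then c₁ else l j) ∨
    ((∀ r, ¬Sit1 c₁ l r) ∧ l' = l)

open Classical in
/-- Check of situation 2, applied to the longest run. -/
def Step2 {q : ℕ} (c₂ : ℝ) (l l' : Fin q → ℝ) : Prop :=
  (∃ s, IsLeast {s | Sit2 c₂ l s} s ∧ l' = fun j => if s ≤ j then c₂ else l j) ∨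
    ((∀ s, ¬Sit2 c₂ l s) ∧ l' = l)

open Classical in
/-- Check of situation 3, applied to any run that cannot be enlarged. -/
def Step3 {q : ℕ} (β : ℝ) (d l l' : Fin q → ℝ) : Prop :=
  (∃ i m, Sit3 l i m ∧ (∀ i' m', Sit3 l i' m' → i' ≤ i → m ≤ m' → i' = i ∧ m' = m) ∧
      l' = fun j => if i ≤ j ∧ j ≤ m then
        phi β ((∑ t ∈ Finset.Icc i m, d t) / ((m : ℝ) - (i : ℝ) + 1)) else l j) ∨
    ((∀ i m, ¬Sit3 l i m) ∧ l' = l)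

/-- One pass of the loop, entered only while the constraints are violated. -/
def Pass {q : ℕ} (β c₁ c₂ : ℝ) (d l l' : Fin q → ℝ) : Prop :=
  l ∉ Slam c₁ c₂ ∧ ∃ l₁ l₂, Step1 c₁ l l₁ ∧ Step2 c₂ l₁ l₂ ∧ Step3 β d l₂ l'

/-- `l` is returned by the iterative procedure for the eigenvalues `λ` with input `d`. -/
def LamOutput {q : ℕ} (β c₁ c₂ : ℝ) (d l : Fin q → ℝ) : Prop :=
  Relation.ReflTransGen (Pass β c₁ c₂ d) (fun i => phi β (d i)) l ∧ l ∈ Slam c₁ c₂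

/-- `y` is a minimizer of `‖y - e‖²` over `C`. -/
def IsNearest {n : ℕ} (C : Set (Fin n → ℝ)) (e y : Fin n → ℝ) : Prop :=
  y ∈ C ∧ ∀ y' ∈ C, ∑ i, (y i - e i) ^ 2 ≤ ∑ i, (y' i - e i) ^ 2

/-- One iteration of the algorithm, from `x` to `y`. -/
def Problem.Iteration (P : Problem p k z) (x y : Var p k z) : Prop :=
  y.w = P.updateW x ∧
  (∃ d, Monotone d ∧ IsEigenvectors (lapOp y.w) d (idxU p k) y.U) ∧
  (∃ d, Antitone d ∧ IsEigenvectors (adjOp y.w) d (idxV p z) y.V) ∧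
  LamOutput P.β P.c₁ P.c₂ (y.Uᵀ * lapOp y.w * y.U).diag y.lam ∧
  IsNearest P.Sψ (y.Vᵀ * adjOp y.w * y.V).diag y.psi

end Blocks

end SGLA

end

/-!
The iteration converges to KKT points because it is a block descent method whose blocks `U`, `λ`,
`V`, `ψ` are solved exactly, and whose block `w` is moved by a projected gradient step.

*Descent.* For orthonormal `U` the penalty `‖ℒw - U Diag(λ) Uᵀ‖²` depends on `U` only through
`∑ λᵢ (Uᵀ ℒw U)ᵢᵢ` (`frobSq_sub_conj`). Eigenvectors maximize such a sum when the weights, padded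
by zeros, are ordered like the eigenvalues (`sum_mul_diag_conj_le`, by Birkhoff's theorem and the
rearrangement inequality); the padding assumption on `Sψ` provides this ordering in the `V`-step.
Since the diagonal of `Uᵀ ℒw U` is nondecreasing, the procedure for `λ` returns the values `φ(dᵢ)`
clipped to `[c₁, c₂]` (`LamOutput.eq_clip`), which are the exact minimizers. As
`‖ℒ*ℒ‖ ≤ 2p` and `‖𝒜*𝒜‖ ≤ 2`, the step in `w` decreases the objective by a multiple of its squared
length. Altogether this is `Problem.Iteration.cost_le`. The objective is coercive on the feasible
set (`Problem.exists_mem_coordBox`), so the iterates stay in a compact set and the steps in `w` tend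
to zero.

*Limit points.* After the first step every iterate satisfies the closed conditions
`Problem.BlockOptimal`. Hence so does every limit point, and the `w`-step leaves it fixed.
The KKT multipliers of such a point can be written down (`Problem.BlockOptimal.isKKTWith`): the
gradient in `w`; partial sums of the residuals `β (λᵢ - dᵢ) - 1 / λᵢ`; diagonal matrices for the
orthogonality constraints; and `γ (e - ψ)`, which is normal to `Sψ` because `ψ` is the projection
of `e`. For polyhedral `Sψ` Farkas' lemma rewrites the last multiplier. A KKT point is stationary
because the objective minus the Lagrangian is minimal there over the feasible set
(`Problem.IsKKT.isStationary`). Convergence to the set of KKT points follows by compactness.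
-/

namespace SGLA

/-! ### The Frobenius inner product -/

/-- The Frobenius inner product of two matrices. -/
def frobInner {m n : ℕ} (M N : Matrix (Fin m) (Fin n) ℝ) : ℝ := ∑ i, ∑ j, M i j * N i j

section Frobenius

variable {m n : ℕ}

lemma frobSq_eq_frobInner (M : Matrix (Fin m) (Fin n) ℝ) : frobSq M = frobInner M M := by
  simp [frobSq, frobInner, sq]

lemma frobInner_eq_trace (M N : Matrix (Fin m) (Fin n) ℝ) : frobInner M N = (Mᵀ * N).trace := by
  simp only [frobInner, Matrix.trace, Matrix.diag, Matrix.mul_apply, Matrix.transpose_apply]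
  exact Finset.sum_comm

lemma frobInner_comm (M N : Matrix (Fin m) (Fin n) ℝ) : frobInner M N = frobInner N M := by
  simp only [frobInner, mul_comm]

lemma frobInner_add_left (M N R : Matrix (Fin m) (Fin n) ℝ) :
    frobInner (M + N) R = frobInner M R + frobInner N R := by
  simp [frobInner, add_mul, Finset.sum_add_distrib]

lemma frobInner_sub_left (M N R : Matrix (Fin m) (Fin n) ℝ) :
    frobInner (M - N) R = frobInner M R - frobInner N R := by
  simp [frobInner, sub_mul, Finset.sum_sub_distrib]

lemma frobSq_add (M N : Matrix (Fin m) (Fin n) ℝ) :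
    frobSq (M + N) = frobSq M + 2 * frobInner M N + frobSq N := by
  simp only [frobSq, frobInner, Matrix.add_apply, Finset.mul_sum, ← Finset.sum_add_distrib]
  exact Finset.sum_congr rfl fun i _ => Finset.sum_congr rfl fun j _ => by ring

lemma frobSq_sub (M N : Matrix (Fin m) (Fin n) ℝ) :
    frobSq (M - N) = frobSq M - 2 * frobInner M N + frobSq N := by
  simp only [frobSq, frobInner, Matrix.sub_apply, Finset.mul_sum, ← Finset.sum_add_distrib,
    ← Finset.sum_sub_distrib]
  exact Finset.sum_congr rfl fun i _ => Finset.sum_congr rfl fun j _ => by ring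

lemma frobSq_nonneg (M : Matrix (Fin m) (Fin n) ℝ) : 0 ≤ frobSq M :=
  Finset.sum_nonneg fun _ _ => Finset.sum_nonneg fun _ _ => sq_nonneg _

lemma sq_apply_le_frobSq (M : Matrix (Fin m) (Fin n) ℝ) (i : Fin m) (j : Fin n) :
    M i j ^ 2 ≤ frobSq M :=
  (Finset.single_le_sum (f := fun j => M i j ^ 2) (fun _ _ => sq_nonneg _)
    (Finset.mem_univ j)).trans
  (Finset.single_le_sum (f := fun i => ∑ j, M i j ^ 2)
    (fun _ _ => Finset.sum_nonneg fun _ _ => sq_nonneg _) (Finset.mem_univ i))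

lemma frobInner_conj (B : Matrix (Fin m) (Fin m) ℝ) (X : Matrix (Fin m) (Fin n) ℝ)
    (v : Fin n → ℝ) :
    frobInner B (X * diagonal v * Xᵀ) = ∑ i, v i * (Xᵀ * B * X).diag i := by
  have h : (Bᵀ * (X * diagonal v * Xᵀ)).trace = (diagonal v * (Xᵀ * B * X)ᵀ).trace := by
    rw [Matrix.transpose_mul, Matrix.transpose_mul, Matrix.transpose_transpose,
      Matrix.mul_assoc X, ← Matrix.mul_assoc Bᵀ, Matrix.trace_mul_comm]
    simp only [Matrix.mul_assoc]
  rw [frobInner_eq_trace, h]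
  simp [Matrix.trace, Matrix.diagonal_mul, -Matrix.transpose_mul]

lemma frobSq_conj {X : Matrix (Fin m) (Fin n) ℝ} (hX : Xᵀ * X = 1) (v : Fin n → ℝ) :
    frobSq (X * diagonal v * Xᵀ) = ∑ i, v i ^ 2 := by
  have h : Xᵀ * (X * diagonal v * Xᵀ) * X = diagonal v := by
    calc _ = (Xᵀ * X) * diagonal v * (Xᵀ * X) := by simp only [Matrix.mul_assoc]
      _ = _ := by rw [hX]; simp
  rw [frobSq_eq_frobInner, frobInner_conj, h]
  simp [sq]

/-- The penalty `‖B - X Diag(v) Xᵀ‖²` sees `X` only through the diagonal of `Xᵀ B X`. -/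
lemma frobSq_sub_conj (B : Matrix (Fin m) (Fin m) ℝ) {X : Matrix (Fin m) (Fin n) ℝ}
    (hX : Xᵀ * X = 1) (v : Fin n → ℝ) :
    frobSq (B - X * diagonal v * Xᵀ)
      = frobSq B - 2 * ∑ i, v i * (Xᵀ * B * X).diag i + ∑ i, v i ^ 2 := by
  rw [frobSq_sub, frobInner_conj, frobSq_conj hX]

lemma sq_apply_le_one {X : Matrix (Fin m) (Fin n) ℝ} (hX : Xᵀ * X = 1) (i : Fin m) (j : Fin n) :
    X i j ^ 2 ≤ 1 := by
  have h := congrFun (congrFun hX j) j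
  simp only [Matrix.mul_apply, Matrix.transpose_apply, Matrix.one_apply_eq, ← sq] at h
  rw [← h]
  exact Finset.single_le_sum (f := fun i => X i j ^ 2) (fun _ _ => sq_nonneg _) (Finset.mem_univ i)

lemma frobSq_smul (c : ℝ) (M : Matrix (Fin m) (Fin n) ℝ) :
    frobSq (c • M) = c ^ 2 * frobSq M := by
  simp [frobSq, mul_pow, Finset.mul_sum]

lemma frobInner_smul_right (c : ℝ) (M N : Matrix (Fin m) (Fin n) ℝ) :
    frobInner M (c • N) = c * frobInner M N := by
  simp only [frobInner, Matrix.smul_apply, smul_eq_mul, Finset.mul_sum]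
  exact Finset.sum_congr rfl fun i _ => Finset.sum_congr rfl fun j _ => by ring

lemma frobSq_transpose (M : Matrix (Fin m) (Fin n) ℝ) : frobSq Mᵀ = frobSq M :=
  Finset.sum_comm

lemma frobSq_sub_le (M N : Matrix (Fin m) (Fin n) ℝ) :
    frobSq (M - N) ≤ 2 * frobSq M + 2 * frobSq N := by
  have := frobSq_nonneg (M + N)
  rw [frobSq_add] at this
  rw [frobSq_sub]; linarith

lemma frobInner_mul_right {l : ℕ} (M : Matrix (Fin m) (Fin n) ℝ) (D : Matrix (Fin m) (Fin l) ℝ)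
    (E : Matrix (Fin l) (Fin n) ℝ) : frobInner M (D * E) = frobInner (M * Eᵀ) D := by
  rw [frobInner_eq_trace, frobInner_eq_trace, Matrix.transpose_mul, Matrix.transpose_transpose,
    Matrix.mul_assoc, Matrix.trace_mul_comm E, Matrix.mul_assoc]

lemma frobInner_transpose (M N : Matrix (Fin m) (Fin n) ℝ) :
    frobInner Mᵀ Nᵀ = frobInner M N := Finset.sum_comm

lemma frobInner_smul_left (c : ℝ) (M N : Matrix (Fin m) (Fin n) ℝ) :
    frobInner (c • M) N = c * frobInner M N := by
  rw [frobInner_comm, frobInner_smul_right, frobInner_comm]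

lemma mul_diagonal_mul_transpose_apply (Y Z : Matrix (Fin m) (Fin n) ℝ)
    (u : Fin n → ℝ) (i j : Fin m) :
    (Y * diagonal u * Zᵀ) i j = ∑ a, Y i a * u a * Z j a := by
  rw [Matrix.mul_apply]
  exact Finset.sum_congr rfl fun a _ => by rw [Matrix.mul_diagonal, Matrix.transpose_apply]

end Frobenius

/-! ### The graph operators -/

section Operators

variable {p : ℕ}

lemma weight_self (w : Edge p → ℝ) (i : Fin p) : weight w i i = 0 := by simp [weight]

lemma weight_comm (w : Edge p → ℝ) (i j : Fin p) : weight w i j = weight w j i := by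
  rcases lt_trichotomy i j with h | rfl | h
  · simp [weight, h, h.not_gt]
  · rfl
  · simp [weight, h, h.not_gt]

lemma weight_edge (w : Edge p → ℝ) (e : Edge p) : weight w e.1.1 e.1.2 = w e := by
  simp [weight, e.2]

lemma weight_add (w w' : Edge p → ℝ) (i j : Fin p) :
    weight (w + w') i j = weight w i j + weight w' i j := by
  unfold weight; split_ifs <;> simp

lemma weight_smul (c : ℝ) (w : Edge p → ℝ) (i j : Fin p) :
    weight (c • w) i j = c * weight w i j := by
  unfold weight; split_ifs <;> simp

lemma adjOp_add (w w' : Edge p → ℝ) : adjOp (w + w') = adjOp w + adjOp w' := by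
  ext i j; simp [adjOp, weight_add]

lemma adjOp_smul (c : ℝ) (w : Edge p → ℝ) : adjOp (c • w) = c • adjOp w := by
  ext i j; simp [adjOp, weight_smul]

lemma lapOp_add (w w' : Edge p → ℝ) : lapOp (w + w') = lapOp w + lapOp w' := by
  ext i j
  simp only [lapOp, weight_add, Matrix.of_apply, Matrix.add_apply, Finset.sum_add_distrib]
  split_ifs <;> ring

lemma lapOp_smul (c : ℝ) (w : Edge p → ℝ) : lapOp (c • w) = c • lapOp w := by
  ext i j
  simp only [lapOp, weight_smul, Matrix.of_apply, Matrix.smul_apply, ← Finset.mul_sum, smul_eq_mul]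
  split_ifs <;> ring

lemma adjOp_transpose (w : Edge p → ℝ) : (adjOp w)ᵀ = adjOp w := by
  ext i j; simp [adjOp, weight_comm w i j]

lemma lapOp_transpose (w : Edge p → ℝ) : (lapOp w)ᵀ = lapOp w := by
  ext i j
  by_cases h : i = j
  · simp [lapOp, h]
  · simp [lapOp, h, Ne.symm h, weight_comm w i j]

lemma lapOp_edge (w : Edge p → ℝ) (e : Edge p) : lapOp w e.1.1 e.1.2 = -w e := by
  have : e.1.1 ≠ e.1.2 := e.2.ne'
  simp [lapOp, this, weight_edge]

/-- Summation over ordered pairs of vertices, reorganized by edges. -/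
lemma sum_weight_mul (w : Edge p → ℝ) (Z : Fin p → Fin p → ℝ) :
    ∑ i, ∑ j, weight w i j * Z i j = ∑ e : Edge p, w e * (Z e.1.1 e.1.2 + Z e.1.2 e.1.1) := by
  have h1 : ∀ Y : Fin p → Fin p → ℝ,
      ∑ i, ∑ j, (if j < i then weight w i j else 0) * Y i j
        = ∑ e : Edge p, w e * Y e.1.1 e.1.2 := by
    intro Y
    rw [← Finset.sum_product' Finset.univ Finset.univ
      (fun i j => (if j < i then weight w i j else 0) * Y i j), Finset.univ_product_univ]
    simp only [ite_mul, zero_mul]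
    rw [← Finset.sum_filter, Finset.sum_subtype (p := fun e : Fin p × Fin p => e.2 < e.1)
      (Finset.univ.filter fun e : Fin p × Fin p => e.2 < e.1) (by simp)]
    exact Finset.sum_congr rfl fun e _ => by rw [weight_edge]
  have h2 : ∀ i j, weight w i j * Z i j = (if j < i then weight w i j else 0) * Z i j
      + (if i < j then weight w j i else 0) * Z i j := by
    intro i j
    rcases lt_trichotomy i j with h | rfl | h
    · simp [h, h.not_gt, weight_comm w i j]
    · simp [weight_self]
    · simp [h, h.not_gt]
  simp only [h2, Finset.sum_add_distrib, mul_add]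
  rw [h1, Finset.sum_comm, h1 fun i j => Z j i]

lemma frobInner_adjOp (w : Edge p → ℝ) (Y : Matrix (Fin p) (Fin p) ℝ) :
    frobInner (adjOp w) Y = w ⬝ᵥ adjAdj Y := by
  simp only [frobInner, adjOp, Matrix.of_apply, dotProduct, adjAdj]
  exact sum_weight_mul w Y

lemma frobInner_lapOp (w : Edge p → ℝ) (Y : Matrix (Fin p) (Fin p) ℝ) :
    frobInner (lapOp w) Y = w ⬝ᵥ lapAdj Y := by
  have h : frobInner (lapOp w) Y = ∑ i, ∑ j, weight w i j * (Y i i - Y i j) := by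
    refine Finset.sum_congr rfl fun i _ => ?_
    have : ∀ j, lapOp w i j * Y i j
        = (if i = j then (∑ l, weight w i l) * Y i i else 0) - weight w i j * Y i j := by
      intro j
      by_cases hij : i = j
      · subst hij; simp [lapOp, weight_self]
      · simp [lapOp, hij]
    simp only [this, Finset.sum_sub_distrib, mul_sub, Finset.sum_ite_eq, Finset.mem_univ, if_true,
      Finset.sum_mul]
  rw [h, sum_weight_mul]
  refine Finset.sum_congr rfl fun e _ => ?_
  simp only [lapAdj]; ring

lemma frobSq_adjOp (w : Edge p → ℝ) : frobSq (adjOp w) = 2 * ∑ e, w e ^ 2 := by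
  rw [frobSq_eq_frobInner, frobInner_adjOp, Finset.mul_sum]
  refine Finset.sum_congr rfl fun e _ => ?_
  simp only [adjAdj, adjOp, Matrix.of_apply]
  rw [weight_comm w e.1.2, weight_edge]; ring

lemma lapAdj_transpose (Y : Matrix (Fin p) (Fin p) ℝ) : lapAdj Yᵀ = lapAdj Y := by
  ext e; simp only [lapAdj, Matrix.transpose_apply]; ring

lemma trace_mul_lapOp (K : Matrix (Fin p) (Fin p) ℝ) (w : Edge p → ℝ) :
    (K * lapOp w).trace = w ⬝ᵥ lapAdj K := by
  rw [← lapAdj_transpose, ← frobInner_lapOp, frobInner_eq_trace, lapOp_transpose,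
    ← Matrix.trace_transpose, Matrix.transpose_mul, lapOp_transpose]

/-- `‖ℒ*ℒ‖ ≤ 2p`: by Cauchy-Schwarz over the `p - 1` pairs that contain a given vertex. -/
lemma frobSq_lapOp_le (w : Edge p → ℝ) : frobSq (lapOp w) ≤ 2 * p * ∑ e, w e ^ 2 := by
  have h : ∀ i, ∑ j, lapOp w i j ^ 2 ≤ p * ∑ j, weight w i j ^ 2 := by
    intro i
    have h1 : ∑ l, weight w i l = ∑ l ∈ Finset.univ.erase i, weight w i l := by
      rw [← Finset.add_sum_erase _ _ (Finset.mem_univ i), weight_self, zero_add]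
    have h2 : ∑ l, weight w i l ^ 2 = ∑ l ∈ Finset.univ.erase i, weight w i l ^ 2 := by
      rw [← Finset.add_sum_erase _ _ (Finset.mem_univ i), weight_self]; simp
    have h3 : ∑ j ∈ Finset.univ.erase i, lapOp w i j ^ 2
        = ∑ l ∈ Finset.univ.erase i, weight w i l ^ 2 := by
      refine Finset.sum_congr rfl fun j hj => ?_
      have : i ≠ j := (Finset.ne_of_mem_erase hj).symm
      simp [lapOp, this]
    have h4 := sq_sum_le_card_mul_sum_sq (s := Finset.univ.erase i) (f := fun l => weight w i l)
    have h5 : ((Finset.univ.erase i).card : ℝ) = p - 1 := by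
      rw [Finset.card_erase_of_mem (Finset.mem_univ i), Finset.card_univ, Fintype.card_fin,
        Nat.cast_sub i.pos]; simp
    rw [h5] at h4
    have h6 : lapOp w i i = ∑ l ∈ Finset.univ.erase i, weight w i l := by
      rw [← h1]; simp [lapOp]
    rw [← Finset.add_sum_erase _ _ (Finset.mem_univ i), h3, h2, h6]
    linarith
  have h7 := frobSq_adjOp w
  simp only [frobSq, adjOp, Matrix.of_apply] at h7
  calc frobSq (lapOp w) ≤ ∑ i, p * ∑ j, weight w i j ^ 2 := Finset.sum_le_sum fun i _ => h i
    _ = _ := by rw [← Finset.mul_sum, h7]; ring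

end Operators

/-! ### The trace inequality behind the eigenvector steps -/

section Trace

variable {p n : ℕ}

/-- The rearrangement inequality for doubly stochastic matrices, which by Birkhoff's theorem are
convex combinations of permutations. -/
lemma sum_mul_doublyStochastic_le {f g : Fin p → ℝ} (hfg : Monovary f g)
    {M : Matrix (Fin p) (Fin p) ℝ} (hM : M ∈ doublyStochastic ℝ (Fin p)) :
    ∑ i, f i * ∑ j, M i j * g j ≤ ∑ i, f i * g i := by
  obtain ⟨c, hc0, hc1, hcM⟩ := exists_eq_sum_perm_of_mem_doublyStochastic hM
  have h : ∀ i, ∑ j, M i j * g j = ∑ σ : Equiv.Perm (Fin p), c σ * g (σ i) := by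
    intro i
    rw [← hcM]
    simp only [Matrix.sum_apply, Matrix.smul_apply, smul_eq_mul, Finset.sum_mul]
    rw [Finset.sum_comm]
    refine Finset.sum_congr rfl fun σ _ => ?_
    simp [Equiv.Perm.permMatrix, PEquiv.toMatrix_apply, Equiv.toPEquiv_apply]
  calc ∑ i, f i * ∑ j, M i j * g j
      = ∑ σ : Equiv.Perm (Fin p), c σ * ∑ i, f i * g (σ i) := by
        simp only [h, Finset.mul_sum]
        rw [Finset.sum_comm]
        exact Finset.sum_congr rfl fun σ _ => Finset.sum_congr rfl fun i _ => by ring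
    _ ≤ ∑ σ : Equiv.Perm (Fin p), c σ * ∑ i, f i * g i :=
        Finset.sum_le_sum fun σ _ =>
          mul_le_mul_of_nonneg_left hfg.sum_mul_comp_perm_le_sum_mul (hc0 σ)
    _ = _ := by rw [← Finset.sum_mul, hc1, one_mul]

/-- Orthonormal columns are columns, at prescribed positions, of a square orthogonal matrix. -/
lemma exists_orthogonal_submatrix_eq {X : Matrix (Fin p) (Fin n) ℝ} (hX : Xᵀ * X = 1)
    {idx : Fin n → Fin p} (hidx : Function.Injective idx) :
    ∃ O : Matrix (Fin p) (Fin p) ℝ, Oᵀ * O = 1 ∧ O.submatrix id idx = X := by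
  let c : Fin n → EuclideanSpace ℝ (Fin p) := fun i => WithLp.toLp 2 fun a => X a i
  let v : Fin p → EuclideanSpace ℝ (Fin p) := Function.extend idx c 0
  have hv : ∀ i, v (idx i) = c i := fun i => hidx.extend_apply c 0 i
  have hc : ∀ i j, inner ℝ (c i) (c j) = if i = j then (1 : ℝ) else 0 := by
    intro i j
    have h := congrFun (congrFun hX i) j
    rw [Matrix.one_apply] at h
    rw [← h]
    simp [c, PiLp.inner_apply, Matrix.mul_apply, mul_comm]
  have horth : Orthonormal ℝ ((Set.range idx).domRestrict v) := by
    rw [orthonormal_iff_ite]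
    rintro ⟨_, i, rfl⟩ ⟨_, j, rfl⟩
    simp only [Set.domRestrict_apply, hv, hc]
    exact if_congr ⟨fun h => Subtype.ext (congrArg idx h),
      fun h => hidx (congrArg Subtype.val h)⟩ rfl rfl
  obtain ⟨b, hb⟩ := horth.exists_orthonormalBasis_extension_of_card_eq (by simp)
  refine ⟨Matrix.of fun a j => b j a, ?_, ?_⟩
  · ext i j
    have h := orthonormal_iff_ite.1 b.orthonormal i j
    rw [Matrix.one_apply, ← h]
    simp [PiLp.inner_apply, Matrix.mul_apply, mul_comm]
  · ext a i
    simp [hb (idx i) ⟨i, rfl⟩, hv, c]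

/-- The vector of `ℝᵖ` that carries the entries of `v` at the positions `idx`, and zeros
elsewhere. -/
def pad (idx : Fin n → Fin p) (v : Fin n → ℝ) (j : Fin p) : ℝ :=
  ∑ i, if idx i = j then v i else 0

lemma sum_pad_mul (idx : Fin n → Fin p) (v : Fin n → ℝ) (f : Fin p → ℝ) :
    ∑ j, pad idx v j * f j = ∑ i, v i * f (idx i) := by
  simp only [pad, Finset.sum_mul]
  rw [Finset.sum_comm]
  simp

/-- Among matrices `X` with orthonormal columns, eigenvectors of `A` maximize
`∑ i, v i (Xᵀ A X) i i`, as soon as the eigenvalues are ordered like the padded weights. -/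
lemma sum_mul_diag_conj_le {A Q : Matrix (Fin p) (Fin p) ℝ} {d : Fin p → ℝ} (hQ : Qᵀ * Q = 1)
    (hA : A * Q = Q * diagonal d) {idx : Fin n → Fin p} (hidx : Function.Injective idx)
    {v : Fin n → ℝ} (hmono : Monovary (pad idx v) d)
    {X : Matrix (Fin p) (Fin n) ℝ} (hX : Xᵀ * X = 1) :
    ∑ i, v i * (Xᵀ * A * X).diag i ≤ ∑ i, v i * d (idx i) := by
  obtain ⟨O, hO, rfl⟩ := exists_orthogonal_submatrix_eq hX hidx
  have hQ' : Q * Qᵀ = 1 := mul_eq_one_comm.1 hQ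
  have hO' : O * Oᵀ = 1 := mul_eq_one_comm.1 hO
  set R := Oᵀ * Q with hR
  have hRR : R * Rᵀ = 1 := by
    rw [hR, Matrix.transpose_mul, Matrix.transpose_transpose, Matrix.mul_assoc,
      ← Matrix.mul_assoc Q, hQ', Matrix.one_mul, hO]
  have hRR' : Rᵀ * R = 1 := mul_eq_one_comm.1 hRR
  have hconj : Oᵀ * A * O = R * diagonal d * Rᵀ := by
    have : A = Q * diagonal d * Qᵀ := by rw [← hA, Matrix.mul_assoc, hQ', Matrix.mul_one]
    rw [hR, Matrix.transpose_mul, Matrix.transpose_transpose, this]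
    simp only [Matrix.mul_assoc]
  have hM : (Matrix.of fun i j => R i j ^ 2) ∈ doublyStochastic ℝ (Fin p) := by
    refine mem_doublyStochastic_iff_sum.2 ⟨fun i j => sq_nonneg _, fun i => ?_, fun j => ?_⟩
    · have h := congrFun (congrFun hRR i) i
      simpa [Matrix.mul_apply, ← sq] using h
    · have h := congrFun (congrFun hRR' j) j
      simpa [Matrix.mul_apply, ← sq] using h
  have hdiag : ∀ i, (Oᵀ * A * O) i i = ∑ j, R i j ^ 2 * d j := by
    intro i
    rw [hconj, Matrix.mul_apply]
    refine Finset.sum_congr rfl fun j _ => ?_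
    rw [Matrix.mul_diagonal, Matrix.transpose_apply]; ring
  have hsub : ∀ i, (((O.submatrix id idx)ᵀ * A * O.submatrix id idx).diag i)
      = ∑ j, R (idx i) j ^ 2 * d j := by
    intro i
    rw [← hdiag]
    simp [Matrix.mul_apply]
  have h := sum_mul_doublyStochastic_le hmono hM
  rw [sum_pad_mul, sum_pad_mul] at h
  simpa only [hsub, Matrix.of_apply] using h

lemma IsEigenvectors.orthonormal {A : Matrix (Fin p) (Fin p) ℝ} {d : Fin p → ℝ}
    {idx : Fin n → Fin p} (hidx : Function.Injective idx) {X : Matrix (Fin p) (Fin n) ℝ}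
    (h : IsEigenvectors A d idx X) : Xᵀ * X = 1 := by
  obtain ⟨Q, hQ, -, rfl⟩ := h
  ext i j
  have h := congrFun (congrFun hQ (idx i)) (idx j)
  simp only [Matrix.one_apply, hidx.eq_iff] at h
  rw [Matrix.one_apply, ← h]
  simp [Matrix.mul_apply]

lemma IsEigenvectors.mul_eq {A : Matrix (Fin p) (Fin p) ℝ} {d : Fin p → ℝ}
    {idx : Fin n → Fin p} {X : Matrix (Fin p) (Fin n) ℝ}
    (h : IsEigenvectors A d idx X) : A * X = X * diagonal (d ∘ idx) := by
  obtain ⟨Q, -, hA, rfl⟩ := h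
  ext i j
  have h := congrFun (congrFun hA i) (idx j)
  rw [Matrix.mul_diagonal] at h ⊢
  simpa [Matrix.mul_apply] using h

lemma IsEigenvectors.diag_eq {A : Matrix (Fin p) (Fin p) ℝ} {d : Fin p → ℝ}
    {idx : Fin n → Fin p} (hidx : Function.Injective idx) {X : Matrix (Fin p) (Fin n) ℝ}
    (h : IsEigenvectors A d idx X) : (Xᵀ * A * X).diag = d ∘ idx := by
  rw [Matrix.mul_assoc, h.mul_eq, ← Matrix.mul_assoc, h.orthonormal hidx, Matrix.one_mul,
    Matrix.diag_diagonal]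

lemma IsEigenvectors.mul_eq_diag {A : Matrix (Fin p) (Fin p) ℝ} {d : Fin p → ℝ}
    {idx : Fin n → Fin p} (hidx : Function.Injective idx) {X : Matrix (Fin p) (Fin n) ℝ}
    (h : IsEigenvectors A d idx X) : A * X = X * diagonal (Xᵀ * A * X).diag := by
  rw [h.diag_eq hidx, h.mul_eq]

lemma IsEigenvectors.sum_mul_diag_le {A : Matrix (Fin p) (Fin p) ℝ} {d : Fin p → ℝ}
    {idx : Fin n → Fin p} (hidx : Function.Injective idx) {X Y : Matrix (Fin p) (Fin n) ℝ}
    (h : IsEigenvectors A d idx Y) {v : Fin n → ℝ} (hmono : Monovary (pad idx v) d)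
    (hX : Xᵀ * X = 1) :
    ∑ i, v i * (Xᵀ * A * X).diag i ≤ ∑ i, v i * (Yᵀ * A * Y).diag i := by
  rw [h.diag_eq hidx]
  obtain ⟨Q, hQ, hA, -⟩ := h
  exact sum_mul_diag_conj_le hQ hA hidx hmono hX

lemma idxU_strictMono (p k : ℕ) : StrictMono (idxU p k) := by
  intro i j h
  have : i.1 < j.1 := h
  change i.1 + k < j.1 + k
  omega

lemma idxV_strictMono (p z : ℕ) : StrictMono (idxV p z) := by
  intro i j h
  have : i.1 < j.1 := h
  rw [Fin.lt_def]
  unfold idxV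
  split_ifs <;> simp <;> omega

/-- Zeros inserted in front of a nonnegative nondecreasing vector keep it nondecreasing. -/
lemma monotone_pad_idxU {p k : ℕ} {v : Fin (p - k) → ℝ} (hv : Monotone v) (h0 : ∀ i, 0 ≤ v i) :
    Monotone (pad (idxU p k) v) := by
  intro j j' hj
  have hnn : ∀ l, 0 ≤ pad (idxU p k) v l := fun l =>
    Finset.sum_nonneg fun i _ => by split_ifs; exacts [h0 i, le_rfl]
  have hpad : ∀ i, pad (idxU p k) v (idxU p k i) = v i := by
    intro i
    simp [pad, (idxU_strictMono p k).injective.eq_iff]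
  by_cases hk : j.1 < k
  · have : pad (idxU p k) v j = 0 := by
      refine Finset.sum_eq_zero fun i _ => if_neg fun h => ?_
      have : i.1 + k = j.1 := congrArg Fin.val h
      omega
    rw [this]; exact hnn j'
  · have hjj : j.1 ≤ j'.1 := hj
    have e1 : idxU p k ⟨j.1 - k, by omega⟩ = j := by ext; simp [idxU]; omega
    have e2 : idxU p k ⟨j'.1 - k, by omega⟩ = j' := by ext; simp [idxU]; omega
    rw [← e1, ← e2, hpad, hpad]
    exact hv (by simp [Fin.le_def]; omega)

end Trace

/-! ### The eigenvalue step -/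

section Lambda

variable {q : ℕ} {β c₁ c₂ : ℝ}

lemma phi_pos (hβ : 0 < β) (d : ℝ) : 0 < phi β d := by
  have h : |d| < √(d ^ 2 + 4 / β) := by
    rw [← Real.sqrt_sq_eq_abs]
    exact Real.sqrt_lt_sqrt (sq_nonneg d) (by linarith [div_pos four_pos hβ])
  have := neg_abs_le d
  unfold phi; linarith

/-- `φ(d)` is the positive root of `β u² - β d u - 1`. -/
lemma phi_root (hβ : 0 < β) (d : ℝ) : β * phi β d ^ 2 - β * d * phi β d = 1 := by
  have h : √(d ^ 2 + 4 / β) ^ 2 = d ^ 2 + 4 / β :=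
    Real.sq_sqrt (by positivity)
  have h4 : β * (4 / β) = 4 := by field_simp
  unfold phi
  linear_combination β / 4 * h + h4 / 4

lemma phi_mono (hβ : 0 < β) : Monotone (phi β) := by
  intro a b hab
  by_contra! h
  have ha := phi_root hβ a
  have hb := phi_root hβ b
  have pa := phi_pos hβ a
  have pb := phi_pos hβ b
  -- on the positive axis `u - 1 / (β u)` increases with `u`, and it takes the value `d` at `φ(d)`
  have h1 : β * (a - b) * (phi β a * phi β b)
      = (phi β a - phi β b) * (β * (phi β a * phi β b) + 1) := by
    linear_combination (-phi β b) * ha + phi β a * hb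
  have h2 : 0 < (phi β a - phi β b) * (β * (phi β a * phi β b) + 1) := by
    have := sub_pos.2 h
    positivity
  have h3 : β * (a - b) * (phi β a * phi β b) ≤ 0 :=
    mul_nonpos_of_nonpos_of_nonneg
      (mul_nonpos_of_nonneg_of_nonpos hβ.le (by linarith)) (by positivity)
  linarith

lemma phi_continuous (β : ℝ) : Continuous (phi β) := by
  unfold phi; fun_prop

/-- The derivative `β (l - d) - 1 / l` of `u ↦ -log u + β / 2 (u - d)²`, in factored form. -/
lemma resid_eq (hβ : 0 < β) {l : ℝ} (hl : 0 < l) (d : ℝ) :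
    β * (l - d) - 1 / l = (l - phi β d) * (β + 1 / (l * phi β d)) := by
  have h := phi_root hβ d
  have hp := phi_pos hβ d
  field_simp
  linear_combination l * h

/-- The loop invariant of the eigenvalue procedure: the entries that `φ` sends below `c₁` or above
`c₂` stay there, and the others are never touched. -/
def LamInv (β c₁ c₂ : ℝ) (d l : Fin q → ℝ) : Prop :=
  ∀ i, (phi β (d i) ≤ c₁ → l i ≤ c₁) ∧ (c₂ ≤ phi β (d i) → c₂ ≤ l i) ∧
    (c₁ < phi β (d i) → phi β (d i) < c₂ → l i = phi β (d i))

lemma LamInv.step1 (hc : c₁ < c₂) {d l l' : Fin q → ℝ} (h : LamInv β c₁ c₂ d l)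
    (hs : Step1 c₁ l l') : LamInv β c₁ c₂ d l' := by
  rcases hs with ⟨r, hr, rfl⟩ | ⟨-, rfl⟩
  · intro i
    obtain ⟨h1, h2, h3⟩ := h i
    by_cases hi : i ≤ r
    · have hl : l i ≤ c₁ := hr.1.1 i hi
      simp only [hi, if_true]
      refine ⟨fun _ => le_rfl, fun hu => ?_, fun hu hu' => ?_⟩
      · linarith [h2 hu]
      · linarith [h3 hu hu']
    · simpa only [hi, if_false] using h i
  · exact h

lemma LamInv.step2 (hc : c₁ < c₂) {d l l' : Fin q → ℝ} (h : LamInv β c₁ c₂ d l)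
    (hs : Step2 c₂ l l') : LamInv β c₁ c₂ d l' := by
  rcases hs with ⟨s, hr, rfl⟩ | ⟨-, rfl⟩
  · intro i
    obtain ⟨h1, h2, h3⟩ := h i
    by_cases hi : s ≤ i
    · have hl : c₂ ≤ l i := hr.1.1 i hi
      simp only [hi, if_true]
      refine ⟨fun hu => ?_, fun _ => le_rfl, fun hu hu' => ?_⟩
      · linarith [h1 hu]
      · linarith [h3 hu hu']
    · simpa only [hi, if_false] using h i
  · exact h

lemma natCast_card_Icc {i m : Fin q} (him : i ≤ m) :
    ((Finset.Icc i m).card : ℝ) = (m : ℝ) - (i : ℝ) + 1 := by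
  have : i.1 ≤ m.1 := him
  rw [Fin.card_Icc, Nat.cast_sub (by omega)]
  push_cast; ring

/-- For a nondecreasing `d` a decreasing run lies entirely among the entries sent below `c₁`, or
entirely among those sent above `c₂`, and so does the average that replaces it. -/
lemma LamInv.step3 (hβ : 0 < β) (hc : c₁ < c₂) {d l l' : Fin q → ℝ} (hd : Monotone d)
    (h : LamInv β c₁ c₂ d l) (hs : Step3 β d l l') : LamInv β c₁ c₂ d l' := by
  rcases hs with ⟨i, m, ⟨him, hanti, hlt⟩, -, rfl⟩ | ⟨-, rfl⟩
  swap
  · exact h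
  have hφ : Monotone fun j => phi β (d j) := (phi_mono hβ).comp hd
  have hcard := natCast_card_Icc him
  have hpos : (0 : ℝ) < (m : ℝ) - (i : ℝ) + 1 := by
    have : (i : ℝ) ≤ m := by exact_mod_cast him
    linarith
  have hhi : (∑ t ∈ Finset.Icc i m, d t) / ((m : ℝ) - (i : ℝ) + 1) ≤ d m := by
    rw [div_le_iff₀ hpos, ← hcard, mul_comm, ← nsmul_eq_mul]
    exact Finset.sum_le_card_nsmul _ _ _ fun t ht => hd (Finset.mem_Icc.1 ht).2
  have hlo : d i ≤ (∑ t ∈ Finset.Icc i m, d t) / ((m : ℝ) - (i : ℝ) + 1) := by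
    rw [le_div_iff₀ hpos, ← hcard, mul_comm, ← nsmul_eq_mul]
    exact Finset.card_nsmul_le_sum _ _ _ fun t ht => hd (Finset.mem_Icc.1 ht).1
  have hside : phi β (d m) ≤ c₁ ∨ c₂ ≤ phi β (d i) := by
    by_contra! hcon
    obtain ⟨hm, hi⟩ := hcon
    have hIm := h m
    have hIi := h i
    have hmono : phi β (d i) ≤ phi β (d m) := hφ him
    rcases le_or_gt (phi β (d i)) c₁ with hi1 | hi1
    · have := hIi.1 hi1
      rcases le_or_gt c₂ (phi β (d m)) with hm2 | hm2
      · linarith [hIm.2.1 hm2]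
      · linarith [hIm.2.2 hm hm2]
    · have := hIi.2.2 hi1 hi
      rcases le_or_gt c₂ (phi β (d m)) with hm2 | hm2
      · linarith [hIm.2.1 hm2]
      · linarith [hIm.2.2 hm hm2]
  intro j
  by_cases hj : i ≤ j ∧ j ≤ m
  · simp only [hj, and_self, if_true]
    have h1 : phi β (d i) ≤ phi β (d j) := hφ hj.1
    have h2 : phi β (d j) ≤ phi β (d m) := hφ hj.2
    have h3 := phi_mono hβ hhi
    have h4 := phi_mono hβ hlo
    rcases hside with hm | hi
    · exact ⟨fun _ => h3.trans hm, fun hu => by linarith, fun hu => by linarith⟩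
    · exact ⟨fun hu => by linarith, fun _ => hi.trans h4, fun _ hu => by linarith⟩
  · simpa only [hj, if_false] using h j

/-- For nondecreasing input the procedure, when it stops, returns the values `φ(dᵢ)` clipped to
`[c₁, c₂]`. -/
lemma LamOutput.eq_clip (hβ : 0 < β) (hc : c₁ ≤ c₂) {d l : Fin q → ℝ} (hd : Monotone d)
    (h : LamOutput β c₁ c₂ d l) (i : Fin q) : l i = max c₁ (min (phi β (d i)) c₂) := by
  obtain ⟨hrun, hmem⟩ := h
  have hbox := hmem.2 i
  -- for `c₁ = c₂` the box is a single point, and no loop invariant is needed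
  rcases hc.eq_or_lt with rfl | hlt
  · rw [max_eq_left (min_le_right _ _)]
    exact le_antisymm hbox.2 hbox.1
  have hinv : LamInv β c₁ c₂ d l := by
    clear hmem hbox
    induction hrun with
    | refl => exact fun i => ⟨id, id, fun _ _ => rfl⟩
    | tail _ hpass ih =>
      obtain ⟨-, l₁, l₂, h1, h2, h3⟩ := hpass
      exact ((ih.step1 hlt h1).step2 hlt h2).step3 hβ hlt hd h3
  obtain ⟨h1, h2, h3⟩ := hinv i
  rcases le_or_gt (phi β (d i)) c₁ with hu | hu
  · rw [max_eq_left ((min_le_left _ _).trans hu)]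
    exact le_antisymm (h1 hu) hbox.1
  rcases le_or_gt c₂ (phi β (d i)) with hu' | hu'
  · rw [min_eq_right hu', max_eq_right hc]
    exact le_antisymm hbox.2 (h2 hu')
  · rw [min_eq_left hu'.le, max_eq_right hu.le]
    exact h3 hu hu'

/-- The first-order conditions over `[c₁, c₂]` at a clipped value: the residual
`β (l - d) - 1 / l` vanishes unless a bound is attained. -/
lemma clip_first_order (hβ : 0 < β) (hc₁ : 0 < c₁) {d l : ℝ}
    (h : l = max c₁ (min (phi β d) c₂)) :
    (0 < β * (l - d) - 1 / l → l = c₁) ∧ (β * (l - d) - 1 / l < 0 → c₂ ≤ l) := by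
  have hl : 0 < l := h ▸ lt_max_of_lt_left hc₁
  have hp := phi_pos hβ d
  have hfac : 0 < β + 1 / (l * phi β d) := by positivity
  rw [resid_eq hβ hl]
  constructor
  · intro hg
    have : phi β d < l := sub_pos.1 (pos_of_mul_pos_left hg hfac.le)
    by_contra hne
    have hmin : l = min (phi β d) c₂ := by
      rcases max_choice c₁ (min (phi β d) c₂) with h' | h'
      · exact absurd (h.trans h') hne
      · exact h.trans h'
    linarith [min_le_left (phi β d) c₂]
  · intro hg
    have : l < phi β d := sub_neg.1 (neg_of_mul_neg_left hg hfac.le)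
    by_contra! hlt
    have hmin : min (phi β d) c₂ ≤ l := h ▸ le_max_right _ _
    exact absurd hmin (not_le.2 (lt_min this hlt))

/-- The clipped value minimizes `u ↦ -log u + β / 2 (u² - 2 u d)` over `[c₁, c₂]`. -/
lemma clip_minimizes (hβ : 0 < β) (hc₁ : 0 < c₁) {d l u : ℝ}
    (h : l = max c₁ (min (phi β d) c₂)) (hu : c₁ ≤ u ∧ u ≤ c₂) :
    -Real.log l + β / 2 * (l ^ 2 - 2 * (l * d)) ≤ -Real.log u + β / 2 * (u ^ 2 - 2 * (u * d)) := by
  obtain ⟨h1, h2⟩ := clip_first_order hβ hc₁ h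
  have hl : 0 < l := h ▸ lt_max_of_lt_left hc₁
  have hu0 : 0 < u := hc₁.trans_le hu.1
  have hg : 0 ≤ (β * (l - d) - 1 / l) * (u - l) := by
    rcases lt_trichotomy (β * (l - d) - 1 / l) 0 with hneg | h0 | hpos
    · exact mul_nonneg_of_nonpos_of_nonpos hneg.le (by linarith [h2 hneg])
    · rw [h0, zero_mul]
    · exact mul_nonneg hpos.le (by linarith [h1 hpos])
  have hlog := Real.log_le_sub_one_of_pos (div_pos hu0 hl)
  rw [Real.log_div hu0.ne' hl.ne'] at hlog
  have e : u / l - 1 = 1 / l * (u - l) := by field_simp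
  nlinarith [mul_nonneg hβ.le (sq_nonneg (u - l))]

end Lambda

/-! ### Finitely generated normal cones -/

/-- **Farkas' lemma** for finitely many vectors. In the inductive step a vector `x₀` that violates
the conclusion for the shorter list is used to project all vectors along the new one. -/
lemma exists_nonneg_combination {n : ℕ} : ∀ {s : ℕ} (a : Fin s → Fin n → ℝ) (b : Fin n → ℝ),
    (∀ x, (∀ j, a j ⬝ᵥ x ≤ 0) → b ⬝ᵥ x ≤ 0) →
      ∃ ρ : Fin s → ℝ, (∀ j, 0 ≤ ρ j) ∧ b = ∑ j, ρ j • a j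
  | 0, a, b, h => by
    refine ⟨0, fun _ => le_rfl, ?_⟩
    simpa using dotProduct_self_eq_zero.1
      (le_antisymm (h b fun j => j.elim0) (Finset.sum_nonneg fun i _ => mul_self_nonneg (b i)))
  | s + 1, a, b, h => by
    by_cases hs : ∀ x, (∀ j : Fin s, a j.succ ⬝ᵥ x ≤ 0) → b ⬝ᵥ x ≤ 0
    · obtain ⟨ρ, h0, hρ⟩ := exists_nonneg_combination (fun j => a j.succ) b hs
      refine ⟨Fin.cons 0 ρ, fun j => Fin.cases (by simp) (by simpa using h0) j, ?_⟩
      simpa [Fin.sum_univ_succ] using hρ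
    push Not at hs
    obtain ⟨x₀, hx₀, hb₀⟩ := hs
    have hpos : 0 < a 0 ⬝ᵥ x₀ := by
      by_contra! hle
      exact absurd (h x₀ fun j => Fin.cases hle hx₀ j) (not_le.2 hb₀)
    set c := a 0 ⬝ᵥ x₀ with hc
    obtain ⟨ρ, h0, hρ⟩ := exists_nonneg_combination
      (fun j : Fin s => a j.succ - (a j.succ ⬝ᵥ x₀ / c) • a 0) (b - (b ⬝ᵥ x₀ / c) • a 0) (by
        intro x hx
        have hproj : ∀ y : Fin n → ℝ, (y - (y ⬝ᵥ x₀ / c) • a 0) ⬝ᵥ x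
            = y ⬝ᵥ (x - (a 0 ⬝ᵥ x / c) • x₀) := by
          intro y
          simp only [sub_dotProduct, dotProduct_sub, smul_dotProduct, dotProduct_smul, smul_eq_mul]
          ring
        rw [hproj]
        refine h _ fun j => Fin.cases ?_ (fun j => ?_) j
        · rw [dotProduct_sub, dotProduct_smul, smul_eq_mul, ← hc, div_mul_cancel₀ _ hpos.ne',
            sub_self]
        · rw [← hproj]; exact hx j)
    refine ⟨Fin.cons (b ⬝ᵥ x₀ / c - ∑ j, ρ j * (a j.succ ⬝ᵥ x₀ / c)) ρ, fun j => ?_, ?_⟩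
    · refine Fin.cases ?_ (by simpa using h0) j
      have : ∑ j, ρ j * (a j.succ ⬝ᵥ x₀ / c) ≤ 0 := Finset.sum_nonpos fun j _ =>
        mul_nonpos_of_nonneg_of_nonpos (h0 j) (div_nonpos_of_nonpos_of_nonneg (hx₀ j) hpos.le)
      have : 0 < b ⬝ᵥ x₀ / c := div_pos hb₀ hpos
      simp only [Fin.cons_zero]; linarith
    · rw [Fin.sum_univ_succ, ← sub_eq_iff_eq_add', Fin.cons_zero, sub_smul, ← sub_add, hρ]
      simp only [Fin.cons_succ, smul_sub, Finset.sum_sub_distrib, Finset.sum_smul,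
        smul_smul]
      abel

/-- The normal cone of a polyhedron is generated by the active constraint normals. -/
lemma normalCone_subset_multiplierCone {n s : ℕ} (a : Fin s → Fin n → ℝ) (r : Fin s → ℝ)
    {C : Set (Fin n → ℝ)} (hC : C = {ψ | ∀ j, a j ⬝ᵥ ψ ≤ r j}) {y : Fin n → ℝ} (hy : y ∈ C) :
    normalCone C y ⊆ multiplierCone a r y := by
  classical
  subst hC
  intro ν hν
  have hy : ∀ j, a j ⬝ᵥ y ≤ r j := hy
  obtain ⟨ρ, h0, hρ⟩ := exists_nonneg_combination
    (fun j => if a j ⬝ᵥ y = r j then a j else 0) ν (by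
      intro x hx
      -- a small step from `y` along `x` stays in the polyhedron
      have hev : ∀ j, ∀ᶠ t : ℝ in 𝓝[>] 0, a j ⬝ᵥ (y + t • x) ≤ r j := by
        intro j
        by_cases hj : a j ⬝ᵥ y = r j
        · have hxj := hx j
          simp only [hj, if_true] at hxj
          filter_upwards [self_mem_nhdsWithin] with t ht
          rw [dotProduct_add, dotProduct_smul, hj, smul_eq_mul]
          have := mul_nonpos_of_nonneg_of_nonpos (le_of_lt (Set.mem_Ioi.1 ht)) hxj
          linarith
        · have hlt : a j ⬝ᵥ y < r j := lt_of_le_of_ne (hy j) hj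
          have hcont : Tendsto (fun t : ℝ => a j ⬝ᵥ (y + t • x)) (𝓝 0) (𝓝 (a j ⬝ᵥ y)) := by
            have : Continuous fun t : ℝ => a j ⬝ᵥ y + t * (a j ⬝ᵥ x) := by fun_prop
            simpa [dotProduct_add, dotProduct_smul] using this.tendsto 0
          exact ((hcont.mono_left nhdsWithin_le_nhds).eventually_lt_const hlt).mono
            fun t ht => le_of_lt ht
      obtain ⟨t, hmem, ht⟩ := ((eventually_all.2 hev).and self_mem_nhdsWithin).exists
      have h := hν (y + t • x) hmem
      rw [add_sub_cancel_left, dotProduct_smul, smul_eq_mul] at h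
      exact nonpos_of_mul_nonpos_right h ht)
  refine ⟨fun j => if a j ⬝ᵥ y = r j then ρ j else 0, fun j => ?_, fun j => ?_, ?_⟩
  · dsimp only; split_ifs; exacts [h0 j, le_rfl]
  · dsimp only; split_ifs with hj
    · rw [hj, sub_self, mul_zero]
    · rw [zero_mul]
  · rw [hρ]
    refine Finset.sum_congr rfl fun j _ => ?_
    by_cases hj : a j ⬝ᵥ y = r j <;> simp [hj]

/-! ### Descent -/

section Descent

variable {p k z : ℕ} {P : Problem p k z}

/-- The conditions, all closed, that every iterate after the first step satisfies: feasibility of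
`w`, and optimality of `U`, `λ`, `V`, `ψ` for the given `w`. The eigenvector property is expressed
through `Uᵀ (ℒ w) U` alone, with no reference to a full eigenbasis. -/
structure Problem.BlockOptimal (P : Problem p k z) (x : Var p k z) : Prop where
  w_nonneg : ∀ e, 0 ≤ x.w e
  U_orth : x.Uᵀ * x.U = 1
  U_eig : lapOp x.w * x.U = x.U * diagonal (x.Uᵀ * lapOp x.w * x.U).diag
  lam_mono : Monotone x.lam
  lam_eq : ∀ i, x.lam i = max P.c₁ (min (phi P.β ((x.Uᵀ * lapOp x.w * x.U).diag i)) P.c₂)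
  V_orth : x.Vᵀ * x.V = 1
  V_eig : adjOp x.w * x.V = x.V * diagonal (x.Vᵀ * adjOp x.w * x.V).diag
  psi_nearest : IsNearest P.Sψ (x.Vᵀ * adjOp x.w * x.V).diag x.psi

lemma Problem.BlockOptimal.lam_mem {x : Var p k z} (h : P.BlockOptimal x) (hc : P.c₁ ≤ P.c₂) :
    x.lam ∈ Slam P.c₁ P.c₂ :=
  ⟨h.lam_mono, fun i => by
    rw [h.lam_eq i]; exact ⟨le_max_left _ _, max_le hc (min_le_right _ _)⟩⟩

lemma Problem.BlockOptimal.feasible {x : Var p k z} (h : P.BlockOptimal x) (hc : P.c₁ ≤ P.c₂) :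
    x ∈ P.feasible :=
  ⟨h.w_nonneg, h.U_orth, h.lam_mem hc, h.V_orth, h.psi_nearest.1⟩

lemma Problem.Iteration.blockOptimal {x y : Var p k z} (h : P.Iteration x y) (hβ : 0 < P.β)
    (hc : P.c₁ ≤ P.c₂) : P.BlockOptimal y := by
  obtain ⟨hw, ⟨d, hd, hU⟩, ⟨e, -, hV⟩, hlam, hpsi⟩ := h
  have iU := (idxU_strictMono p k).injective
  have iV := (idxV_strictMono p z).injective
  refine ⟨fun e => ?_, hU.orthonormal iU, hU.mul_eq_diag iU, hlam.2.1, fun i => ?_,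
    hV.orthonormal iV, hV.mul_eq_diag iV, hpsi⟩
  · rw [hw]; exact le_max_right _ _
  · refine hlam.eq_clip hβ hc ?_ i
    rw [hU.diag_eq iU]
    exact hd.comp (idxU_strictMono p k).monotone

lemma Problem.Iteration.antitone_padZeros {x y : Var p k z} (h : P.Iteration x y)
    (hord : ∀ e ψ : Fin (p - z) → ℝ, Antitone e → IsNearest P.Sψ e ψ → Antitone (padZeros p z ψ)) :
    Antitone (padZeros p z y.psi) := by
  obtain ⟨-, -, ⟨e, he, hV⟩, -, hpsi⟩ := h
  refine hord _ _ ?_ hpsi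
  rw [hV.diag_eq (idxV_strictMono p z).injective]
  exact he.comp_monotone (idxV_strictMono p z).monotone

lemma log_det_diagonal {n : ℕ} {l : Fin n → ℝ} (hl : ∀ i, l i ≠ 0) :
    Real.log (diagonal l).det = ∑ i, Real.log (l i) := by
  rw [Matrix.det_diagonal, Real.log_prod fun i _ => hl i]

/-- The objective at points with orthonormal `U`, `V`, where the penalties separate. -/
lemma Problem.cost_eq {w : Edge p → ℝ} {U : Matrix (Fin p) (Fin (p - k)) ℝ}
    {l : Fin (p - k) → ℝ} {V : Matrix (Fin p) (Fin (p - z)) ℝ} {ψ : Fin (p - z) → ℝ}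
    (hU : Uᵀ * U = 1) (hV : Vᵀ * V = 1) (hl : ∀ i, l i ≠ 0) :
    P.cost (w, U, l, V, ψ) = (P.K * lapOp w).trace + P.β / 2 * frobSq (lapOp w)
      + P.γ / 2 * frobSq (adjOp w)
      + ∑ i, (-Real.log (l i) + P.β / 2 * (l i ^ 2 - 2 * (l i * (Uᵀ * lapOp w * U).diag i)))
      + P.γ / 2 * (∑ i, ψ i ^ 2 - 2 * ∑ i, ψ i * (Vᵀ * adjOp w * V).diag i) := by
  rw [Problem.cost, frobSq_sub_conj _ hU, frobSq_sub_conj _ hV, log_det_diagonal hl]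
  simp only [Finset.sum_add_distrib, Finset.sum_neg_distrib, ← Finset.mul_sum,
    Finset.sum_sub_distrib]
  ring

lemma Problem.dotProduct_gradW (hβ : P.β ≠ 0) (x : Var p k z) (δ : Edge p → ℝ) :
    δ ⬝ᵥ P.gradW x = (P.K * lapOp δ).trace
      + P.β * frobInner (lapOp δ) (lapOp x.w - x.U * diagonal x.lam * x.Uᵀ)
      + P.γ * frobInner (adjOp δ) (adjOp x.w - x.V * diagonal x.psi * x.Vᵀ) := by
  rw [trace_mul_lapOp, frobInner_lapOp, frobInner_adjOp, ← smul_eq_mul, ← smul_eq_mul,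
    ← dotProduct_smul, ← dotProduct_smul, ← dotProduct_add, ← dotProduct_add]
  congr 1
  ext e
  simp only [Problem.gradW, lapAdj, adjAdj, Pi.add_apply, Pi.sub_apply, Pi.smul_apply,
    Matrix.sub_apply, Matrix.smul_apply, smul_eq_mul]
  field_simp
  ring

/-- Expansion of the objective, a quadratic function of `w`. -/
lemma Problem.cost_add_w (hβ : P.β ≠ 0) (x : Var p k z) (δ : Edge p → ℝ) :
    P.cost (x.w + δ, x.2) = P.cost x + δ ⬝ᵥ P.gradW x + P.β / 2 * frobSq (lapOp δ)
      + P.γ / 2 * frobSq (adjOp δ) := by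
  have h1 : lapOp (x.w + δ) - x.U * diagonal x.lam * x.Uᵀ
      = (lapOp x.w - x.U * diagonal x.lam * x.Uᵀ) + lapOp δ := by rw [lapOp_add]; abel
  have h2 : adjOp (x.w + δ) - x.V * diagonal x.psi * x.Vᵀ
      = (adjOp x.w - x.V * diagonal x.psi * x.Vᵀ) + adjOp δ := by rw [adjOp_add]; abel
  rw [P.dotProduct_gradW hβ]
  unfold Problem.cost
  dsimp only [Var.w, Var.U, Var.lam, Var.V, Var.psi] at h1 h2 ⊢
  rw [h1, h2, frobSq_add, frobSq_add, lapOp_add, Matrix.mul_add, Matrix.trace_add,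
    frobInner_comm (lapOp δ), frobInner_comm (adjOp δ)]
  ring

/-- One coordinate of a projected gradient step of length `1 / L`: the linear term of the objective
decreases by at least `L` times the squared step. -/
lemma proj_step_le {L w g : ℝ} (hL : 0 < L) (hw : 0 ≤ w) :
    (max (w - 1 / L * g) 0 - w) * g + L * (max (w - 1 / L * g) 0 - w) ^ 2 ≤ 0 := by
  have e : L * (1 / L * g) = g := by field_simp
  rcases le_total (w - 1 / L * g) 0 with h | h
  · rw [max_eq_right h]
    have : L * w ≤ g := by
      rw [← e]; exact mul_le_mul_of_nonneg_left (by linarith) hL.le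
    nlinarith
  · rw [max_eq_left h]
    have : (w - 1 / L * g - w) * g + L * (w - 1 / L * g - w) ^ 2
        = (1 / L * g) * (L * (1 / L * g) - g) := by ring
    rw [this, e, sub_self, mul_zero]

/-- The projected gradient step decreases the objective, `2pβ + 2γ` being a bound for its second
derivative in `w`. The decrease is stated with `γ` in place of the larger constant `pβ + γ`. -/
lemma Problem.cost_updateW_le (hβ : 0 < P.β) (hγ : 0 < P.γ) {x : Var p k z}
    (hw : ∀ e, 0 ≤ x.w e) :
    P.cost (P.updateW x, x.2) + P.γ * ∑ e, (P.updateW x e - x.w e) ^ 2 ≤ P.cost x := by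
  set L : ℝ := 2 * p * P.β + 2 * P.γ with hL
  have hLγ : 2 * P.γ ≤ L := by
    have : (0 : ℝ) ≤ 2 * p * P.β := by positivity
    linarith
  have hLpos : 0 < L := by linarith
  set δ : Edge p → ℝ := P.updateW x - x.w with hδ
  have hstep : x.w + δ = P.updateW x := by rw [hδ]; abel
  have h1 := P.cost_add_w hβ.ne' x δ
  rw [hstep] at h1
  have h2 := mul_le_mul_of_nonneg_left (frobSq_lapOp_le δ) (half_pos hβ).le
  have h3 := frobSq_adjOp δ
  have h4 : δ ⬝ᵥ P.gradW x + L * ∑ e, δ e ^ 2 ≤ 0 := by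
    rw [dotProduct, Finset.mul_sum, ← Finset.sum_add_distrib]
    exact Finset.sum_nonpos fun e _ => proj_step_le hLpos (hw e)
  have h5 : P.γ * ∑ e, δ e ^ 2 ≤ L / 2 * ∑ e, δ e ^ 2 :=
    mul_le_mul_of_nonneg_right (by linarith) (Finset.sum_nonneg fun e _ => sq_nonneg _)
  have h6 : ∑ e, (P.updateW x e - x.w e) ^ 2 = ∑ e, δ e ^ 2 := rfl
  rw [h1, h3, h6]
  have h7 : P.β / 2 * (2 * p * ∑ e, δ e ^ 2) + P.γ / 2 * (2 * ∑ e, δ e ^ 2)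
      = L / 2 * ∑ e, δ e ^ 2 := by rw [hL]; ring
  linarith

/-- Every iteration that starts at a feasible point decreases the objective by a multiple of the
squared length of the step in `w`. -/
lemma Problem.Iteration.cost_le {x y : Var p k z} (h : P.Iteration x y) (hβ : 0 < P.β)
    (hγ : 0 < P.γ) (hc₁ : 0 < P.c₁) (hc : P.c₁ ≤ P.c₂) (hx : x ∈ P.feasible)
    (hpad : Antitone (padZeros p z x.psi)) :
    P.cost y + P.γ * ∑ e, (y.w e - x.w e) ^ 2 ≤ P.cost x := by
  have hy := h.blockOptimal hβ hc
  obtain ⟨hw, hU, hlam, hV, hpsi⟩ := hx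
  have hxpos : ∀ i, 0 < x.lam i := fun i => hc₁.trans_le (hlam.2 i).1
  have hypos : ∀ i, 0 < y.lam i := fun i => hc₁.trans_le ((hy.lam_mem hc).2 i).1
  have hdesc := P.cost_updateW_le hβ hγ hw
  obtain ⟨hyw, ⟨d, hd, hyU⟩, ⟨e, he, hyV⟩, -, -⟩ := h
  rw [← hyw] at hdesc
  have c1 : P.cost (y.w, x.2) = _ := P.cost_eq (w := y.w) (ψ := x.psi) hU hV fun i => (hxpos i).ne'
  have c2 : P.cost y = _ :=
    P.cost_eq (w := y.w) (ψ := y.psi) hy.U_orth hy.V_orth fun i => (hypos i).ne'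
  -- the four exact block minimizations, each with the remaining blocks as they were before it
  have hUstep := hyU.sum_mul_diag_le (idxU_strictMono p k).injective
    (Monotone.monovary (monotone_pad_idxU hlam.1 fun i => (hxpos i).le) hd) hU
  have hVstep := hyV.sum_mul_diag_le (idxV_strictMono p z).injective
    (v := x.psi) (Antitone.monovary hpad he) hV
  have hlstep : ∀ i ∈ Finset.univ, _ ≤ _ := fun i (_ : i ∈ Finset.univ) =>
    clip_minimizes hβ hc₁ (hy.lam_eq i) (hlam.2 i)
  have hlstep := Finset.sum_le_sum hlstep
  have hpstep := hy.psi_nearest.2 _ hpsi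
  simp only [sub_sq, Finset.sum_add_distrib, Finset.sum_sub_distrib] at hpstep
  simp only [mul_assoc, ← Finset.mul_sum] at hpstep
  have hU' := mul_le_mul_of_nonneg_left hUstep hβ.le
  have hsplit : ∀ X : Matrix (Fin p) (Fin (p - k)) ℝ,
      ∑ i, (-Real.log (x.lam i)
        + P.β / 2 * (x.lam i ^ 2 - 2 * (x.lam i * (Xᵀ * lapOp y.w * X).diag i)))
      = ∑ i, (-Real.log (x.lam i) + P.β / 2 * x.lam i ^ 2)
        - P.β * ∑ i, x.lam i * (Xᵀ * lapOp y.w * X).diag i := by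
    intro X
    rw [Finset.mul_sum, ← Finset.sum_sub_distrib]
    exact Finset.sum_congr rfl fun i _ => by ring
  rw [hsplit] at c1 hlstep
  have hp' : ∑ i, y.psi i ^ 2 - 2 * ∑ i, y.psi i * (y.Vᵀ * adjOp y.w * y.V).diag i
      ≤ ∑ i, x.psi i ^ 2 - 2 * ∑ i, x.psi i * (x.Vᵀ * adjOp y.w * x.V).diag i := by linarith
  have hp'' := mul_le_mul_of_nonneg_left hp' (half_pos hγ).le
  linarith

/-! ### Boundedness -/

/-- Coercivity: the penalties are controlled by the objective, the linear term being absorbed by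
half of the first penalty. -/
lemma Problem.exists_penalty_le (P : Problem p k z) (hβ : 0 < P.β) (hc₁ : 0 < P.c₁) :
    ∃ C, ∀ x ∈ P.feasible,
      P.β / 4 * frobSq (lapOp x.w - x.U * diagonal x.lam * x.Uᵀ)
        + P.γ / 2 * frobSq (adjOp x.w - x.V * diagonal x.psi * x.Vᵀ) ≤ P.cost x + C := by
  refine ⟨(p - k : ℕ) * Real.log P.c₂ + (frobSq P.K / P.β
    + (frobSq P.K + (p - k : ℕ) * P.c₂ ^ 2) / 2), fun x hx => ?_⟩
  obtain ⟨-, hU, hlam, -, -⟩ := hx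
  have hpos : ∀ i, 0 < x.lam i := fun i => hc₁.trans_le (hlam.2 i).1
  set R := x.U * diagonal x.lam * x.Uᵀ with hR
  set M := lapOp x.w - R with hM
  have hlog : Real.log (diagonal x.lam).det ≤ (p - k : ℕ) * Real.log P.c₂ := by
    rw [log_det_diagonal fun i => (hpos i).ne']
    refine (Finset.sum_le_card_nsmul _ _ _ fun i _ =>
      Real.log_le_log (hpos i) (hlam.2 i).2).trans_eq ?_
    simp
  have hRsq : frobSq R ≤ (p - k : ℕ) * P.c₂ ^ 2 := by
    rw [hR, frobSq_conj hU]
    refine (Finset.sum_le_card_nsmul _ _ _ fun i _ =>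
      pow_le_pow_left₀ (hpos i).le (hlam.2 i).2 2).trans_eq ?_
    simp
  have htr : (P.K * lapOp x.w).trace = frobInner P.Kᵀ M + frobInner P.Kᵀ R := by
    rw [frobInner_eq_trace, frobInner_eq_trace, Matrix.transpose_transpose, ← Matrix.trace_add,
      ← Matrix.mul_add, hM, sub_add_cancel]
  have y1 := frobSq_nonneg (P.Kᵀ + (P.β / 2) • M)
  rw [frobSq_add, frobSq_smul, frobInner_smul_right, frobSq_transpose] at y1
  have y2 := frobSq_nonneg (P.Kᵀ + R)
  rw [frobSq_add, frobSq_transpose] at y2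
  have y3 : 0 ≤ frobSq P.K / P.β + frobInner P.Kᵀ M + P.β / 4 * frobSq M := by
    have := div_nonneg y1 hβ.le
    have e : (frobSq P.K + 2 * (P.β / 2 * frobInner P.Kᵀ M) + (P.β / 2) ^ 2 * frobSq M) / P.β
        = frobSq P.K / P.β + frobInner P.Kᵀ M + P.β / 4 * frobSq M := by
      field_simp; ring
    rwa [e] at this
  rw [Problem.cost, htr]
  linarith

/-- The points all of whose coordinates have absolute value at most `B`. -/
def coordBox (p k z : ℕ) (B : ℝ) : Set (Var p k z) :=
  (Set.univ.pi fun _ => Set.Icc (-B) B) ×ˢ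
    ((Set.univ.pi fun _ => Set.univ.pi fun _ => Set.Icc (-B) B) ×ˢ
      ((Set.univ.pi fun _ => Set.Icc (-B) B) ×ˢ
        ((Set.univ.pi fun _ => Set.univ.pi fun _ => Set.Icc (-B) B) ×ˢ
          (Set.univ.pi fun _ => Set.Icc (-B) B))))

lemma isCompact_coordBox (B : ℝ) : IsCompact (coordBox p k z B) := by
  have h1 : ∀ ι : Type, IsCompact (Set.univ.pi fun _ : ι => Set.Icc (-B) B) := fun ι =>
    isCompact_univ_pi fun _ => isCompact_Icc
  have h2 : ∀ ι κ : Type,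
      IsCompact (Set.univ.pi fun _ : ι => Set.univ.pi fun _ : κ => Set.Icc (-B) B) :=
    fun ι κ => isCompact_univ_pi fun _ => h1 κ
  exact (h1 _).prod ((h2 _ _).prod ((h1 _).prod ((h2 _ _).prod (h1 _))))

/-- Sublevel sets of the objective on the feasible set are bounded. -/
lemma Problem.exists_mem_coordBox (P : Problem p k z) (hβ : 0 < P.β) (hγ : 0 < P.γ)
    (hc₁ : 0 < P.c₁) (T : ℝ) :
    ∃ B, ∀ x ∈ P.feasible, P.cost x ≤ T → x ∈ coordBox p k z B := by
  obtain ⟨C, hC⟩ := P.exists_penalty_le hβ hc₁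
  -- bounds for the squared entries: `Bl` for `λ`, `Bw` for `w`, `Bp` for `ψ`, and `1` for `U`, `V`
  set D₁ := 4 / P.β * (T + C) with hD₁
  set D₂ := 2 / P.γ * (T + C) with hD₂
  set Bl := (p - k : ℕ) * P.c₂ ^ 2 with hBl
  set Bw := 2 * D₁ + 2 * Bl with hBw
  set Bp := 2 * (2 * (Fintype.card (Edge p) * Bw)) + 2 * D₂ with hBp
  refine ⟨1 + max (max 1 Bl) (max Bw Bp), fun x hx hT => ?_⟩
  have hpen := hC x hx
  obtain ⟨-, hU, hlam, hV, -⟩ := hx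
  set R := x.U * diagonal x.lam * x.Uᵀ with hR
  set Q := x.V * diagonal x.psi * x.Vᵀ with hQ
  have n1 := mul_nonneg hβ.le (frobSq_nonneg (lapOp x.w - R))
  have n2 := mul_nonneg hγ.le (frobSq_nonneg (adjOp x.w - Q))
  have f1 : frobSq (lapOp x.w - R) ≤ D₁ := by
    rw [hD₁, div_mul_eq_mul_div, le_div_iff₀ hβ]; linarith
  have f2 : frobSq (adjOp x.w - Q) ≤ D₂ := by
    rw [hD₂, div_mul_eq_mul_div, le_div_iff₀ hγ]; linarith
  have hlsum : ∑ i, x.lam i ^ 2 ≤ Bl := by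
    refine (Finset.sum_le_card_nsmul _ _ _ fun i _ =>
      pow_le_pow_left₀ (hc₁.trans_le (hlam.2 i).1).le (hlam.2 i).2 2).trans_eq ?_
    simp [hBl]
  have hl : ∀ i, x.lam i ^ 2 ≤ Bl := fun i =>
    (Finset.single_le_sum (f := fun i => x.lam i ^ 2) (fun _ _ => sq_nonneg _)
      (Finset.mem_univ i)).trans hlsum
  have hRsq : frobSq R ≤ Bl := by rw [hR, frobSq_conj hU]; exact hlsum
  have hlap : frobSq (lapOp x.w) ≤ Bw := by
    have h := frobSq_sub_le (lapOp x.w - R) (-R)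
    have e : frobSq (-R) = frobSq R := by simp [frobSq]
    rw [sub_neg_eq_add, sub_add_cancel, e] at h
    linarith
  have hw : ∀ e, x.w e ^ 2 ≤ Bw := fun e => by
    have h := sq_apply_le_frobSq (lapOp x.w) e.1.1 e.1.2
    rw [lapOp_edge, neg_sq] at h
    exact h.trans hlap
  have hadj : frobSq (adjOp x.w) ≤ 2 * (Fintype.card (Edge p) * Bw) := by
    rw [frobSq_adjOp]
    refine mul_le_mul_of_nonneg_left ?_ zero_le_two
    refine (Finset.sum_le_card_nsmul _ _ _ fun e _ => hw e).trans_eq ?_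
    rw [nsmul_eq_mul, Finset.card_univ]
  have hp : ∀ i, x.psi i ^ 2 ≤ Bp := fun i => by
    have h := frobSq_sub_le (adjOp x.w) (adjOp x.w - Q)
    rw [sub_sub_cancel, hQ, frobSq_conj hV] at h
    have := Finset.single_le_sum (f := fun i => x.psi i ^ 2) (fun _ _ => sq_nonneg _)
      (Finset.mem_univ i)
    linarith
  have key : ∀ a b : ℝ, a ^ 2 ≤ b → b ≤ max (max 1 Bl) (max Bw Bp) →
      a ∈ Set.Icc (-(1 + max (max 1 Bl) (max Bw Bp))) (1 + max (max 1 Bl) (max Bw Bp)) := by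
    intro a b h1 h2
    constructor <;> nlinarith [sq_nonneg (a - 1), sq_nonneg (a + 1)]
  refine ⟨fun e _ => key _ _ (hw e) (by simp), fun i _ j _ => key _ _ (sq_apply_le_one hU i j)
    (by simp), fun i _ => key _ _ (hl i) (by simp), fun i _ j _ =>
    key _ _ (sq_apply_le_one hV i j) (by simp), fun i _ => key _ _ (hp i) (by simp)⟩

end Descent

/-! ### Directional derivatives of the Lagrangian -/

section Derivatives

lemma hasDerivAt_line (a b : ℝ) : HasDerivAt (fun t : ℝ => a + t * b) b 0 := by
  simpa using ((hasDerivAt_id (0 : ℝ)).mul_const b).const_add a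

lemma hasDerivAt_conj_line {m n : ℕ} (B B' : Matrix (Fin m) (Fin m) ℝ)
    (X D : Matrix (Fin m) (Fin n) ℝ) (v v' : Fin n → ℝ) (i j : Fin m) :
    HasDerivAt
      (fun t : ℝ => (B + t • B' - (X + t • D) * diagonal (v + t • v') * (X + t • D)ᵀ) i j)
      ((B' - (D * diagonal v * Xᵀ + X * diagonal v' * Xᵀ + X * diagonal v * Dᵀ)) i j) 0 := by
  simp only [Matrix.sub_apply, Matrix.add_apply, mul_diagonal_mul_transpose_apply, Matrix.smul_apply, smul_eq_mul,
    Pi.add_apply, Pi.smul_apply]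
  refine (hasDerivAt_line _ _).sub ?_
  rw [← Finset.sum_add_distrib, ← Finset.sum_add_distrib]
  refine HasDerivAt.fun_sum fun a _ => ?_
  have h := ((hasDerivAt_line (X i a) (D i a)).mul (hasDerivAt_line (v a) (v' a))).mul
    (hasDerivAt_line (X j a) (D j a))
  refine h.congr_deriv ?_
  simp only [Pi.mul_apply]
  ring

/-- The derivative of `‖B - X Diag(v) Xᵀ‖²` at a point where the columns of `X` are orthonormal
eigenvectors of `B` with eigenvalues `e`. -/
lemma hasDerivAt_penalty {m n : ℕ} {B : Matrix (Fin m) (Fin m) ℝ} (hB : Bᵀ = B)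
    (B' : Matrix (Fin m) (Fin m) ℝ) {X : Matrix (Fin m) (Fin n) ℝ} (hX : Xᵀ * X = 1)
    {e : Fin n → ℝ} (he : B * X = X * diagonal e)
    (D : Matrix (Fin m) (Fin n) ℝ) (v v' : Fin n → ℝ) :
    HasDerivAt
      (fun t : ℝ => frobSq (B + t • B' - (X + t • D) * diagonal (v + t • v') * (X + t • D)ᵀ))
      (2 * frobInner B' (B - X * diagonal v * Xᵀ)
        - 4 * frobInner (X * diagonal fun a => (e a - v a) * v a) D
        - 2 * ∑ a, v' a * (e a - v a)) 0 := by
  set M := B - X * diagonal v * Xᵀ with hM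
  have hMX : M * X = X * diagonal fun a => e a - v a := by
    rw [hM, Matrix.sub_mul, he, Matrix.mul_assoc _ Xᵀ, hX, Matrix.mul_one, ← Matrix.mul_sub,
      Matrix.diagonal_sub]
  have hMt : Mᵀ = M := by
    rw [hM, Matrix.transpose_sub, hB, Matrix.transpose_mul, Matrix.transpose_mul,
      Matrix.transpose_transpose, Matrix.diagonal_transpose, Matrix.mul_assoc]
  have i1 : frobInner M (D * diagonal v * Xᵀ)
      = frobInner (X * diagonal fun a => (e a - v a) * v a) D := by
    rw [Matrix.mul_assoc, frobInner_mul_right, Matrix.transpose_mul, Matrix.transpose_transpose,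
      Matrix.diagonal_transpose, ← Matrix.mul_assoc, hMX, Matrix.mul_assoc,
      Matrix.diagonal_mul_diagonal]
  have i2 : frobInner M (X * diagonal v * Dᵀ) = frobInner M (D * diagonal v * Xᵀ) := by
    rw [← frobInner_transpose, hMt, Matrix.transpose_mul, Matrix.transpose_mul,
      Matrix.transpose_transpose, Matrix.diagonal_transpose, Matrix.mul_assoc]
  have i3 : frobInner M (X * diagonal v' * Xᵀ) = ∑ a, v' a * (e a - v a) := by
    rw [frobInner_conj, Matrix.mul_assoc, hMX, ← Matrix.mul_assoc, hX, Matrix.one_mul,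
      Matrix.diag_diagonal]
  have hder : HasDerivAt
      (fun t : ℝ => frobSq (B + t • B' - (X + t • D) * diagonal (v + t • v') * (X + t • D)ᵀ))
      (2 * frobInner (B' - (D * diagonal v * Xᵀ + X * diagonal v' * Xᵀ + X * diagonal v * Dᵀ)) M)
      0 := by
    have h := HasDerivAt.fun_sum (u := Finset.univ) fun i _ =>
      HasDerivAt.fun_sum (u := Finset.univ) fun j _ =>
        (hasDerivAt_conj_line B B' X D v v' i j).pow 2
    refine h.congr_deriv ?_
    simp only [frobInner, Finset.mul_sum]
    refine Finset.sum_congr rfl fun i _ => Finset.sum_congr rfl fun j _ => ?_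
    simp only [zero_smul, add_zero, ← hM]
    norm_num
    ring
  refine hder.congr_deriv ?_
  rw [frobInner_sub_left, frobInner_add_left, frobInner_add_left,
    frobInner_comm (D * diagonal v * Xᵀ), frobInner_comm (X * diagonal v' * Xᵀ),
    frobInner_comm (X * diagonal v * Dᵀ), i2, i1, i3]
  ring

lemma hasDerivAt_orth_constraint {m n : ℕ} (X D : Matrix (Fin m) (Fin n) ℝ) (c : Fin n → ℝ) :
    HasDerivAt
      (fun t : ℝ => ((diagonal c)ᵀ * ((X + t • D)ᵀ * (X + t • D) - 1)).trace)
      (2 * frobInner (X * diagonal c) D) 0 := by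
  have e1 : (fun t : ℝ => ((diagonal c)ᵀ * ((X + t • D)ᵀ * (X + t • D) - 1)).trace)
      = fun t : ℝ => ∑ a, c a * (∑ i, (X i a + t * D i a) ^ 2 - 1) := by
    ext t
    refine Finset.sum_congr rfl fun a _ => ?_
    rw [Matrix.diag_apply, Matrix.diagonal_transpose, Matrix.diagonal_mul, Matrix.sub_apply,
      Matrix.one_apply_eq, Matrix.mul_apply]
    simp only [Matrix.transpose_apply, Matrix.add_apply, Matrix.smul_apply, smul_eq_mul, sq]
  rw [e1]
  have h := HasDerivAt.fun_sum (u := Finset.univ) fun a _ =>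
    ((HasDerivAt.fun_sum (u := Finset.univ) fun i _ =>
      (hasDerivAt_line (X i a) (D i a)).pow 2).sub_const 1).const_mul (c a)
  refine h.congr_deriv ?_
  simp only [frobInner, Matrix.mul_diagonal, Finset.mul_sum]
  rw [Finset.sum_comm]
  refine Finset.sum_congr rfl fun i _ => Finset.sum_congr rfl fun a _ => ?_
  norm_num
  ring

lemma hasDerivAt_log_det {n : ℕ} {l : Fin n → ℝ} (hl : ∀ i, 0 < l i) (l' : Fin n → ℝ) :
    HasDerivAt (fun t : ℝ => Real.log (diagonal (l + t • l')).det) (∑ i, l' i / l i) 0 := by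
  have hev : ∀ i, ∀ᶠ t : ℝ in 𝓝 0, l i + t * l' i ≠ 0 := fun i =>
    (hasDerivAt_line (l i) (l' i)).continuousAt.eventually_ne (by simpa using (hl i).ne')
  have h := HasDerivAt.fun_sum (u := Finset.univ) fun i _ =>
    (hasDerivAt_line (l i) (l' i)).log (by simpa using (hl i).ne')
  simp only [zero_mul, add_zero] at h
  refine h.congr_of_eventuallyEq ?_
  filter_upwards [eventually_all.2 hev] with t ht
  exact log_det_diagonal ht

lemma dotProduct_chainConstr {q : ℕ} (c₁ c₂ : ℝ) (η : Fin (q + 1) → ℝ) (l : Fin q → ℝ) :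
    η ⬝ᵥ chainConstr c₁ c₂ l
      = η 0 * c₁ - η (Fin.last q) * c₂ - ∑ i, (η i.castSucc - η i.succ) * l i := by
  have e1 : ∑ i, η i * (Fin.cons c₁ l : Fin (q + 1) → ℝ) i
      = η 0 * c₁ + ∑ i : Fin q, η i.succ * l i := by
    rw [Fin.sum_univ_succ]; simp
  have e2 : ∑ i, η i * (Fin.snoc l c₂ : Fin (q + 1) → ℝ) i
      = ∑ i : Fin q, η i.castSucc * l i + η (Fin.last q) * c₂ := by
    rw [Fin.sum_univ_castSucc]; simp
  simp only [dotProduct, chainConstr, mul_sub, Finset.sum_sub_distrib, sub_mul, e1, e2]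
  ring

variable {p k z : ℕ} {P : Problem p k z}

/-- The directional derivative of the Lagrangian, for diagonal multipliers of the orthogonality
constraints, at a point where `U` and `V` consist of eigenvectors. -/
lemma Problem.hasLineDerivAt_lagrangian {x : Var p k z} (hU : x.Uᵀ * x.U = 1)
    {d : Fin (p - k) → ℝ} (hd : lapOp x.w * x.U = x.U * diagonal d) (hl : ∀ i, 0 < x.lam i)
    (hV : x.Vᵀ * x.V = 1)
    {e : Fin (p - z) → ℝ} (he : adjOp x.w * x.V = x.V * diagonal e)
    (μ : Edge p → ℝ) (η : Fin (p - k + 1) → ℝ) (m : Fin (p - k) → ℝ) (n : Fin (p - z) → ℝ)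
    (ν : Fin (p - z) → ℝ) (δ : Var p k z) :
    HasLineDerivAt ℝ (P.lagrangian μ η (diagonal m) (diagonal n) ν)
      (-∑ i, δ.lam i / x.lam i + (P.K * lapOp δ.w).trace
        + P.β / 2 * (2 * frobInner (lapOp δ.w) (lapOp x.w - x.U * diagonal x.lam * x.Uᵀ)
          - 4 * frobInner (x.U * diagonal fun a => (d a - x.lam a) * x.lam a) δ.U
          - 2 * ∑ a, δ.lam a * (d a - x.lam a))
        + P.γ / 2 * (2 * frobInner (adjOp δ.w) (adjOp x.w - x.V * diagonal x.psi * x.Vᵀ)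
          - 4 * frobInner (x.V * diagonal fun a => (e a - x.psi a) * x.psi a) δ.V
          - 2 * ∑ a, δ.psi a * (e a - x.psi a))
        - μ ⬝ᵥ δ.w - ∑ i, (η i.castSucc - η i.succ) * δ.lam i
        + 2 * frobInner (x.U * diagonal m) δ.U + 2 * frobInner (x.V * diagonal n) δ.V
        + ν ⬝ᵥ δ.psi) x δ := by
  have h1 := (hasDerivAt_log_det hl δ.lam).neg
  have h2 := hasDerivAt_line (P.K * lapOp x.w).trace (P.K * lapOp δ.w).trace
  have h3 := (hasDerivAt_penalty (lapOp_transpose x.w) (lapOp δ.w) hU hd δ.U x.lam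
    δ.lam).const_mul (P.β / 2)
  have h4 := (hasDerivAt_penalty (adjOp_transpose x.w) (adjOp δ.w) hV he δ.V x.psi
    δ.psi).const_mul (P.γ / 2)
  have h5 := hasDerivAt_line (μ ⬝ᵥ x.w) (μ ⬝ᵥ δ.w)
  have h6 := hasDerivAt_line (η ⬝ᵥ chainConstr P.c₁ P.c₂ x.lam)
    (-∑ i, (η i.castSucc - η i.succ) * δ.lam i)
  have h7 := hasDerivAt_orth_constraint x.U δ.U m
  have h8 := hasDerivAt_orth_constraint x.V δ.V n
  have h9 := hasDerivAt_line (ν ⬝ᵥ x.psi) (ν ⬝ᵥ δ.psi)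
  have h := ((((((((h1.add h2).add h3).add h4).sub h5).add h6).add h7).add h8).add h9)
  unfold HasLineDerivAt
  refine (h.congr_of_eventuallyEq (Eventually.of_forall fun t => ?_)).congr_deriv (by ring)
  simp only [Problem.lagrangian, Problem.cost, Pi.add_apply, Pi.sub_apply, Pi.neg_apply,
    dotProduct_chainConstr, Var.w, Var.U, Var.lam, Var.V, Var.psi, Prod.fst_add, Prod.snd_add,
    Prod.smul_fst, Prod.smul_snd, lapOp_add, lapOp_smul, adjOp_add, adjOp_smul, Matrix.mul_add,
    Matrix.mul_smul, Matrix.trace_add, Matrix.trace_smul, dotProduct_add, dotProduct_smul,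
    smul_eq_mul, Pi.smul_apply, mul_add, Finset.sum_add_distrib, mul_left_comm _ t,
    ← Finset.mul_sum]
  ring

end Derivatives

/-! ### Multipliers -/

section Multipliers

lemma IsNearest.smul_sub_mem_normalCone {n : ℕ} {C : Set (Fin n → ℝ)} (hC : Convex ℝ C)
    {e y : Fin n → ℝ} (h : IsNearest C e y) {c : ℝ} (hc : 0 ≤ c) :
    c • (e - y) ∈ normalCone C y := by
  intro y' hy'
  rw [smul_dotProduct, smul_eq_mul]
  refine mul_nonpos_of_nonneg_of_nonpos hc ?_
  by_contra! hpos
  set a := (e - y) ⬝ᵥ (y' - y) with ha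
  set b := (y' - y) ⬝ᵥ (y' - y) with hb
  have hb0 : 0 ≤ b := Finset.sum_nonneg fun i _ => mul_self_nonneg _
  -- the point of the segment with parameter `a / (a + b)` would be nearer to `e`
  set s := a / (a + b) with hs
  have hab : 0 < a + b := by linarith
  have hs0 : 0 < s := div_pos hpos hab
  have hs1 : s ≤ 1 := (div_le_one hab).2 (by linarith)
  have hmem : y + s • (y' - y) ∈ C := hC.add_smul_sub_mem h.1 hy' ⟨hs0.le, hs1⟩
  have hle := h.2 _ hmem
  have hexp : ∑ i, ((y + s • (y' - y)) i - e i) ^ 2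
      = ∑ i, (y i - e i) ^ 2 - 2 * s * a + s ^ 2 * b := by
    simp only [ha, hb, dotProduct, Finset.mul_sum, ← Finset.sum_add_distrib,
      ← Finset.sum_sub_distrib]
    refine Finset.sum_congr rfl fun i _ => ?_
    simp only [Pi.add_apply, Pi.smul_apply, Pi.sub_apply, smul_eq_mul]
    ring
  rw [hexp] at hle
  have hsab : s * (a + b) = a := div_mul_cancel₀ _ hab.ne'
  have : s * (2 * a - s * b) ≤ 0 := by linarith
  have h2 : 2 * a - s * b ≤ 0 := nonpos_of_mul_nonpos_right this hs0
  nlinarith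

lemma chainConstr_nonpos {q : ℕ} {c₁ c₂ : ℝ} (hc : c₁ ≤ c₂) {l : Fin q → ℝ}
    (hl : l ∈ Slam c₁ c₂) (i : Fin (q + 1)) : chainConstr c₁ c₂ l i ≤ 0 := by
  refine sub_nonpos.2 ?_
  refine Fin.cases ?_ (fun i' => ?_) i
  · rw [Fin.cons_zero]
    refine Fin.lastCases (motive := fun j => c₁ ≤ (Fin.snoc l c₂ : Fin (q + 1) → ℝ) j)
      ?_ (fun j => ?_) 0
    · simpa using hc
    · simpa using (hl.2 j).1
  · rw [Fin.cons_succ]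
    have key : ∀ j : Fin (q + 1), i'.castSucc ≤ j → l i' ≤ (Fin.snoc l c₂ : Fin (q + 1) → ℝ) j := by
      intro j
      refine Fin.lastCases ?_ (fun j => ?_) j
      · intro _; simpa using (hl.2 i').2
      · intro hj; simpa using hl.1 (Fin.castSucc_le_castSucc_iff.1 hj)
    exact key _ (Fin.castSucc_lt_succ).le

/-- The multipliers of the ordered box: `ηᵢ` collects the positive parts of `g` from position `i`
on, where the lower bound is attained, and the negative parts before position `i`, where the upper
bound is attained. -/
lemma exists_chain_multiplier {q : ℕ} {c₁ c₂ : ℝ} {l g : Fin q → ℝ}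
    (hl : l ∈ Slam c₁ c₂) (hpos : ∀ i, 0 < g i → l i = c₁) (hneg : ∀ i, g i < 0 → c₂ ≤ l i) :
    ∃ η : Fin (q + 1) → ℝ, (∀ i, 0 ≤ η i) ∧ (∀ i, η i * chainConstr c₁ c₂ l i = 0) ∧
      ∀ i : Fin q, η i.castSucc - η i.succ = g i := by
  refine ⟨fun i => ∑ j : Fin q, ((if i ≤ j.castSucc then max (g j) 0 else 0)
    + (if j.castSucc < i then max (-g j) 0 else 0)), fun i => ?_, fun i => ?_, fun i => ?_⟩
  · exact Finset.sum_nonneg fun j _ => add_nonneg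
      (by split_ifs; exacts [le_max_right _ _, le_rfl])
      (by split_ifs; exacts [le_max_right _ _, le_rfl])
  · rw [Finset.sum_mul]
    refine Finset.sum_eq_zero fun j _ => ?_
    rw [add_mul]
    have t1 : (if i ≤ j.castSucc then max (g j) 0 else 0) * chainConstr c₁ c₂ l i = 0 := by
      split_ifs with hij
      swap
      · rw [zero_mul]
      rcases le_or_gt (g j) 0 with hg | hg
      · rw [max_eq_right hg, zero_mul]
      have hlow : ∀ a : Fin q, a ≤ j → l a = c₁ := fun a ha =>
        le_antisymm ((hl.1 ha).trans_eq (hpos j hg)) (hl.2 a).1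
      have e1 : (Fin.cons c₁ l : Fin (q + 1) → ℝ) i = c₁ := by
        revert hij
        refine Fin.cases (by simp) (fun a ha => ?_) i
        rw [Fin.cons_succ]
        exact hlow a (Fin.castSucc_le_castSucc_iff.1 (Fin.castSucc_lt_succ.le.trans ha))
      have e2 : (Fin.snoc l c₂ : Fin (q + 1) → ℝ) i = c₁ := by
        revert hij
        refine Fin.lastCases (fun ha => ?_) (fun a ha => ?_) i
        · exact absurd ha (not_le.2 (Fin.castSucc_lt_last j))
        · rw [Fin.snoc_castSucc]; exact hlow a (Fin.castSucc_le_castSucc_iff.1 ha)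
      rw [chainConstr, e1, e2, sub_self, mul_zero]
    have t2 : (if j.castSucc < i then max (-g j) 0 else 0) * chainConstr c₁ c₂ l i = 0 := by
      split_ifs with hij
      swap
      · rw [zero_mul]
      rcases le_or_gt 0 (g j) with hg | hg
      · rw [max_eq_right (by linarith), zero_mul]
      have hhigh : ∀ a : Fin q, j ≤ a → l a = c₂ := fun a ha =>
        le_antisymm (hl.2 a).2 ((hneg j hg).trans (hl.1 ha))
      have e1 : (Fin.cons c₁ l : Fin (q + 1) → ℝ) i = c₂ := by
        revert hij
        refine Fin.cases (fun ha => absurd ha (Fin.not_lt_zero _)) (fun a ha => ?_) i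
        rw [Fin.cons_succ]
        exact hhigh a (Fin.castSucc_lt_succ_iff.1 ha)
      have e2 : (Fin.snoc l c₂ : Fin (q + 1) → ℝ) i = c₂ := by
        revert hij
        refine Fin.lastCases (by simp) (fun a ha => ?_) i
        rw [Fin.snoc_castSucc]; exact hhigh a (Fin.castSucc_lt_castSucc_iff.1 ha).le
      rw [chainConstr, e1, e2, sub_self, mul_zero]
    rw [t1, t2, add_zero]
  · rw [← Finset.sum_sub_distrib, Finset.sum_eq_single i]
    · simp only [le_refl, if_true, lt_irrefl, if_false, Fin.castSucc_lt_succ,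
        not_le.2 (Fin.castSucc_lt_succ (i := i)), add_zero, zero_add]
      rcases le_total (g i) 0 with h | h
      · rw [max_eq_right h, max_eq_left (by linarith)]; ring
      · rw [max_eq_left h, max_eq_right (by linarith)]; ring
    · intro j _ hji
      have e1 : i.succ ≤ j.castSucc ↔ i.castSucc ≤ j.castSucc := by
        rw [Fin.succ_le_castSucc_iff, Fin.castSucc_le_castSucc_iff]
        exact ⟨le_of_lt, fun h => lt_of_le_of_ne h (Ne.symm hji)⟩
      have e2 : j.castSucc < i.succ ↔ j.castSucc < i.castSucc := by
        rw [Fin.castSucc_lt_succ_iff, Fin.castSucc_lt_castSucc_iff]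
        exact ⟨fun h => lt_of_le_of_ne h hji, le_of_lt⟩
      simp only [e1, e2, sub_self]
    · simp

end Multipliers

/-! ### Fixed points are KKT points, and KKT points are stationary -/

section KKT

variable {p k z : ℕ} {P : Problem p k z}

/-- A block optimal point that the `w`-step leaves unchanged satisfies the KKT conditions; the
multipliers are explicit. -/
lemma Problem.BlockOptimal.isKKTWith {x : Var p k z} (h : P.BlockOptimal x) (hβ : 0 < P.β)
    (hγ : 0 < P.γ) (hc₁ : 0 < P.c₁) (hc : P.c₁ ≤ P.c₂) (hconv : Convex ℝ P.Sψ)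
    (hfix : P.updateW x = x.w) {NC : Set (Fin (p - z) → ℝ)}
    (hNC : normalCone P.Sψ x.psi ⊆ NC) : P.IsKKTWith NC x := by
  have hlam := h.lam_mem hc
  have hl : ∀ i, 0 < x.lam i := fun i => hc₁.trans_le (hlam.2 i).1
  have hL : 0 < 1 / (2 * p * P.β + 2 * P.γ) := by positivity
  set d := (x.Uᵀ * lapOp x.w * x.U).diag with hd
  set e := (x.Vᵀ * adjOp x.w * x.V).diag with he
  obtain ⟨η, hη0, hηc, hηg⟩ := exists_chain_multiplier
    (g := fun i => P.β * (x.lam i - d i) - 1 / x.lam i) hlam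
    (fun i => (clip_first_order hβ hc₁ (h.lam_eq i)).1)
    (fun i => (clip_first_order hβ hc₁ (h.lam_eq i)).2)
  have hw : ∀ i, max (x.w i - 1 / (2 * p * P.β + 2 * P.γ) * P.gradW x i) 0 = x.w i := fun i =>
    congrFun hfix i
  refine ⟨h.feasible hc, P.gradW x, η,
    diagonal (P.β • fun a => (d a - x.lam a) * x.lam a),
    diagonal (P.γ • fun a => (e a - x.psi a) * x.psi a), P.γ • (e - x.psi),
    fun i => ?_, fun i => ?_, hη0, hηc,
    hNC (h.psi_nearest.smul_sub_mem_normalCone hconv hγ.le), fun δ => ?_⟩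
  · by_contra! hneg
    have := le_max_left (x.w i - 1 / (2 * p * P.β + 2 * P.γ) * P.gradW x i) 0
    rw [hw i] at this
    linarith [mul_neg_of_pos_of_neg hL hneg]
  · rcases (h.w_nonneg i).eq_or_lt with h0 | h0
    · rw [← h0, mul_zero]
    · have hmax : x.w i - 1 / (2 * p * P.β + 2 * P.γ) * P.gradW x i = x.w i := by
        rcases max_choice (x.w i - 1 / (2 * p * P.β + 2 * P.γ) * P.gradW x i) 0 with h' | h'
        · rw [← h', hw i]
        · rw [hw i] at h'; exact absurd h' h0.ne'
      have : 1 / (2 * p * P.β + 2 * P.γ) * P.gradW x i = 0 := by linarith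
      rw [(mul_eq_zero.1 this).resolve_left hL.ne', zero_mul]
  · have hder := P.hasLineDerivAt_lagrangian h.U_orth h.U_eig hl h.V_orth h.V_eig (P.gradW x) η
      (P.β • fun a => (d a - x.lam a) * x.lam a) (P.γ • fun a => (e a - x.psi a) * x.psi a)
      (P.γ • (e - x.psi)) δ
    refine HasDerivAt.congr_deriv hder ?_
    have e1 : ∑ i, (η i.castSucc - η i.succ) * δ.lam i
        = -P.β * ∑ a, δ.lam a * (d a - x.lam a) - ∑ i, δ.lam i / x.lam i := by
      rw [Finset.mul_sum, ← Finset.sum_sub_distrib]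
      refine Finset.sum_congr rfl fun i _ => ?_
      rw [hηg]; ring
    have e2 : (P.γ • (e - x.psi)) ⬝ᵥ δ.psi = P.γ * ∑ a, δ.psi a * (e a - x.psi a) := by
      rw [smul_dotProduct, dotProduct_comm]; rfl
    rw [dotProduct_comm (P.gradW x), P.dotProduct_gradW hβ.ne', e1, e2, Matrix.diagonal_smul,
      Matrix.diagonal_smul, Matrix.mul_smul, Matrix.mul_smul, frobInner_smul_left,
      frobInner_smul_left]
    ring

section Differentiability

-- the sup norm of matrices induces the product topology in which tangent cones are taken
attribute [local instance] Matrix.normedAddCommGroup Matrix.normedSpace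

lemma differentiable_lapOp_apply (i j : Fin p) :
    Differentiable ℝ fun w : Edge p → ℝ => lapOp w i j := by
  have hw : ∀ a b : Fin p, Differentiable ℝ fun w : Edge p → ℝ => weight w a b := by
    intro a b; unfold weight; split_ifs <;> fun_prop
  simp only [lapOp, Matrix.of_apply]
  split_ifs <;> fun_prop

lemma differentiable_adjOp_apply (i j : Fin p) :
    Differentiable ℝ fun w : Edge p → ℝ => adjOp w i j := by
  simp only [adjOp, Matrix.of_apply]
  unfold weight; split_ifs <;> fun_prop

lemma differentiable_frobSq_sub_conj {n : ℕ} {E : Type*} [NormedAddCommGroup E] [NormedSpace ℝ E]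
    {B : E → Matrix (Fin p) (Fin p) ℝ} {X : E → Matrix (Fin p) (Fin n) ℝ} {v : E → Fin n → ℝ}
    (hB : ∀ i j, Differentiable ℝ fun x => B x i j) (hX : ∀ i j, Differentiable ℝ fun x => X x i j)
    (hv : ∀ i, Differentiable ℝ fun x => v x i) :
    Differentiable ℝ fun x => frobSq (B x - X x * diagonal (v x) * (X x)ᵀ) := by
  simp only [frobSq, Matrix.sub_apply, mul_diagonal_mul_transpose_apply]
  fun_prop

lemma Problem.differentiableAt_cost {x : Var p k z} (hl : ∀ i, x.lam i ≠ 0) :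
    DifferentiableAt ℝ P.cost x := by
  have hdet : ∏ i, x.lam i ≠ 0 := Finset.prod_ne_zero_iff.2 fun i _ => hl i
  have hU : ∀ i j, Differentiable ℝ fun x : Var p k z => x.U i j := fun i j => by fun_prop
  have hV : ∀ i j, Differentiable ℝ fun x : Var p k z => x.V i j := fun i j => by fun_prop
  have hL : ∀ i j, Differentiable ℝ fun x : Var p k z => lapOp x.w i j := fun i j =>
    (differentiable_lapOp_apply i j).comp differentiable_fst
  have hA : ∀ i j, Differentiable ℝ fun x : Var p k z => adjOp x.w i j := fun i j =>
    (differentiable_adjOp_apply i j).comp differentiable_fst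
  have hlam : ∀ i, Differentiable ℝ fun x : Var p k z => x.lam i := fun i => by fun_prop
  have hpsi : ∀ i, Differentiable ℝ fun x : Var p k z => x.psi i := fun i => by fun_prop
  have h3 := differentiable_frobSq_sub_conj hL hU hlam
  have h4 := differentiable_frobSq_sub_conj hA hV hpsi
  have h2 : Differentiable ℝ fun x : Var p k z => (P.K * lapOp x.w).trace := by
    simp only [Matrix.trace, Matrix.diag_apply, Matrix.mul_apply]
    fun_prop
  have h1 : DifferentiableAt ℝ (fun x : Var p k z => Real.log (diagonal x.lam).det) x := by
    simp only [Matrix.det_diagonal]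
    refine DifferentiableAt.log ?_ hdet
    fun_prop
  exact ((h1.neg.add h2.differentiableAt).add (h3.differentiableAt.const_mul _)).add
    (h4.differentiableAt.const_mul _)

lemma Problem.differentiableAt_lagrangian (μ : Edge p → ℝ) (η : Fin (p - k + 1) → ℝ)
    (M : Matrix (Fin (p - k)) (Fin (p - k)) ℝ) (N : Matrix (Fin (p - z)) (Fin (p - z)) ℝ)
    (ν : Fin (p - z) → ℝ) {x : Var p k z} (hl : ∀ i, x.lam i ≠ 0) :
    DifferentiableAt ℝ (P.lagrangian μ η M N ν) x := by
  have h1 := P.differentiableAt_cost hl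
  have h2 : Differentiable ℝ fun x : Var p k z => μ ⬝ᵥ x.w := by
    unfold dotProduct; fun_prop
  have h3 : Differentiable ℝ fun x : Var p k z => η ⬝ᵥ chainConstr P.c₁ P.c₂ x.lam := by
    simp only [dotProduct_chainConstr]; fun_prop
  have h4 : Differentiable ℝ fun x : Var p k z => (Mᵀ * (x.Uᵀ * x.U - 1)).trace := by
    simp only [Matrix.trace, Matrix.diag_apply, Matrix.mul_apply, Matrix.sub_apply,
      Matrix.transpose_apply]
    fun_prop
  have h5 : Differentiable ℝ fun x : Var p k z => (Nᵀ * (x.Vᵀ * x.V - 1)).trace := by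
    simp only [Matrix.trace, Matrix.diag_apply, Matrix.mul_apply, Matrix.sub_apply,
      Matrix.transpose_apply]
    fun_prop
  have h6 : Differentiable ℝ fun x : Var p k z => ν ⬝ᵥ x.psi := by
    unfold dotProduct; fun_prop
  exact ((((h1.sub h2.differentiableAt).add h3.differentiableAt).add h4.differentiableAt).add
    h5.differentiableAt).add h6.differentiableAt

/-- At a KKT point the objective exceeds the Lagrangian by a function that is minimal there over
the feasible set, and the Lagrangian has zero derivative. -/
lemma Problem.IsKKT.isStationary (hc₁ : 0 < P.c₁) (hc : P.c₁ ≤ P.c₂) {x : Var p k z}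
    (h : P.IsKKT x) : P.IsStationary x := by
  obtain ⟨hx, μ, η, M, N, ν, hμ, hμw, hη, hηc, hν, hder⟩ := h
  have hl : ∀ i, x.lam i ≠ 0 := fun i => (hc₁.trans_le (hx.2.2.1.2 i).1).ne'
  have hF := (P.differentiableAt_cost hl).hasFDerivAt
  have hG := (P.differentiableAt_lagrangian μ η M N ν hl).hasFDerivAt
  refine ⟨hx, fun d hd => ⟨_, hF.hasLineDerivAt d, ?_⟩⟩
  have hval : ∀ y ∈ P.feasible, P.lagrangian μ η M N ν y
      = P.cost y - μ ⬝ᵥ y.w + η ⬝ᵥ chainConstr P.c₁ P.c₂ y.lam + ν ⬝ᵥ y.psi := by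
    rintro y ⟨-, hU, -, hV, -⟩
    rw [Problem.lagrangian, hU, hV]; simp
  have hmin : IsMinOn (fun y => P.cost y - P.lagrangian μ η M N ν y) P.feasible x := by
    intro y hy
    have e1 : μ ⬝ᵥ x.w = 0 := Finset.sum_eq_zero fun i _ => hμw i
    have e2 : η ⬝ᵥ chainConstr P.c₁ P.c₂ x.lam = 0 := Finset.sum_eq_zero fun i _ => hηc i
    have e3 : 0 ≤ μ ⬝ᵥ y.w := Finset.sum_nonneg fun i _ => mul_nonneg (hμ i) (hy.1 i)
    have e4 : η ⬝ᵥ chainConstr P.c₁ P.c₂ y.lam ≤ 0 := Finset.sum_nonpos fun i _ =>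
      mul_nonpos_of_nonneg_of_nonpos (hη i) (chainConstr_nonpos hc hy.2.2.1 i)
    have e5 := hν y.psi hy.2.2.2.2
    rw [dotProduct_sub] at e5
    simp only [Set.mem_ofPred_eq, hval x hx, hval y hy]
    linarith
  have hzero : fderiv ℝ (P.lagrangian μ η M N ν) x d = 0 :=
    HasDerivAt.unique (hG.hasLineDerivAt d) (hder d)
  have hnn := hmin.localize.hasFDerivWithinAt_nonneg (hF.sub hG).hasFDerivWithinAt hd
  have hsub : 0 ≤ fderiv ℝ P.cost x d - fderiv ℝ (P.lagrangian μ η M N ν) x d := hnn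
  rwa [hzero, sub_zero] at hsub

end Differentiability

end KKT

/-! ### Limit points -/

section Limits

variable {p k z : ℕ} {P : Problem p k z}

lemma continuous_lapOp : Continuous fun x : Var p k z => lapOp x.w := by
  have hw : ∀ a b : Fin p, Continuous fun x : Var p k z => weight x.w a b := by
    intro a b; unfold weight; split_ifs <;> fun_prop
  refine continuous_matrix fun i j => ?_
  simp only [lapOp, Matrix.of_apply]
  split_ifs <;> fun_prop

lemma continuous_adjOp : Continuous fun x : Var p k z => adjOp x.w := by
  refine continuous_matrix fun i j => ?_
  simp only [adjOp, Matrix.of_apply]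
  unfold weight; split_ifs <;> fun_prop

lemma Problem.isClosed_blockOptimal (P : Problem p k z) (hclosed : IsClosed P.Sψ) :
    IsClosed {x | P.BlockOptimal x} := by
  refine isClosed_of_closure_subset fun y hy => ?_
  have key : ∀ C : Set (Var p k z), IsClosed C → {x | P.BlockOptimal x} ⊆ C → y ∈ C :=
    fun C hC h => closure_minimal h hC hy
  have cw : Continuous fun x : Var p k z => x.w := continuous_fst
  have cU : Continuous fun x : Var p k z => x.U := by fun_prop
  have cl : Continuous fun x : Var p k z => x.lam := by fun_prop
  have cV : Continuous fun x : Var p k z => x.V := by fun_prop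
  have cψ : Continuous fun x : Var p k z => x.psi := by fun_prop
  have cL := continuous_lapOp (p := p) (k := k) (z := z)
  have cA := continuous_adjOp (p := p) (k := k) (z := z)
  have cd : Continuous fun x : Var p k z => (x.Uᵀ * lapOp x.w * x.U).diag :=
    ((cU.matrix_transpose.matrix_mul cL).matrix_mul cU).matrix_diag
  have ce : Continuous fun x : Var p k z => (x.Vᵀ * adjOp x.w * x.V).diag :=
    ((cV.matrix_transpose.matrix_mul cA).matrix_mul cV).matrix_diag
  refine ⟨fun e => ?_, ?_, ?_, ?_, fun i => ?_, ?_, ?_, ?_, fun ψ hψ => ?_⟩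
  · exact key {x | 0 ≤ x.w e} (isClosed_le continuous_const ((continuous_apply e).comp cw))
      fun x hx => hx.w_nonneg e
  · exact key {x | x.Uᵀ * x.U = 1}
      (isClosed_eq (cU.matrix_transpose.matrix_mul cU) continuous_const) fun x hx => hx.U_orth
  · exact key {x | lapOp x.w * x.U = x.U * diagonal (x.Uᵀ * lapOp x.w * x.U).diag}
      (isClosed_eq (cL.matrix_mul cU) (cU.matrix_mul cd.matrix_diagonal)) fun x hx => hx.U_eig
  · exact key {x | Monotone x.lam} (isClosed_monotone.preimage cl) fun x hx => hx.lam_mono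
  · exact key {x | x.lam i = max P.c₁ (min (phi P.β ((x.Uᵀ * lapOp x.w * x.U).diag i)) P.c₂)}
      (isClosed_eq ((continuous_apply i).comp cl) (continuous_const.max
        (((phi_continuous P.β).comp ((continuous_apply i).comp cd)).min continuous_const)))
      fun x hx => hx.lam_eq i
  · exact key {x | x.Vᵀ * x.V = 1}
      (isClosed_eq (cV.matrix_transpose.matrix_mul cV) continuous_const) fun x hx => hx.V_orth
  · exact key {x | adjOp x.w * x.V = x.V * diagonal (x.Vᵀ * adjOp x.w * x.V).diag}
      (isClosed_eq (cA.matrix_mul cV) (cV.matrix_mul ce.matrix_diagonal)) fun x hx => hx.V_eig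
  · exact key {x | x.psi ∈ P.Sψ} (hclosed.preimage cψ) fun x hx => hx.psi_nearest.1
  · have cψi : ∀ i, Continuous fun x : Var p k z => x.psi i := fun i =>
      (continuous_apply i).comp cψ
    have cei : ∀ i, Continuous fun x : Var p k z => (x.Vᵀ * adjOp x.w * x.V).diag i := fun i =>
      continuous_pi_iff.1 ce i
    exact key {x | ∑ i, (x.psi i - (x.Vᵀ * adjOp x.w * x.V).diag i) ^ 2
        ≤ ∑ i, (ψ i - (x.Vᵀ * adjOp x.w * x.V).diag i) ^ 2}
      (isClosed_le (continuous_finsetSum _ fun i _ => ((cψi i).sub (cei i)).pow 2)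
        (continuous_finsetSum _ fun i _ => (continuous_const.sub (cei i)).pow 2))
      fun x hx => hx.psi_nearest.2 ψ hψ

lemma Problem.continuous_updateW (P : Problem p k z) : Continuous P.updateW := by
  have cU : Continuous fun x : Var p k z => x.U := by fun_prop
  have cl : Continuous fun x : Var p k z => x.lam := by fun_prop
  have cV : Continuous fun x : Var p k z => x.V := by fun_prop
  have cψ : Continuous fun x : Var p k z => x.psi := by fun_prop
  have cL : ∀ i j, Continuous fun x : Var p k z => lapOp x.w i j := fun i j =>
    continuous_lapOp.matrix_elem i j
  have cA : ∀ i j, Continuous fun x : Var p k z => adjOp x.w i j := fun i j =>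
    continuous_adjOp.matrix_elem i j
  have cR : ∀ i j, Continuous fun x : Var p k z => (x.U * diagonal x.lam * x.Uᵀ) i j := fun i j =>
    ((cU.matrix_mul cl.matrix_diagonal).matrix_mul cU.matrix_transpose).matrix_elem i j
  have cQ : ∀ i j, Continuous fun x : Var p k z => (x.V * diagonal x.psi * x.Vᵀ) i j := fun i j =>
    ((cV.matrix_mul cψ.matrix_diagonal).matrix_mul cV.matrix_transpose).matrix_elem i j
  refine continuous_pi fun e => ?_
  simp only [Problem.updateW, Problem.gradW, lapAdj, adjAdj, Pi.add_apply, Pi.sub_apply,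
    Pi.smul_apply, Matrix.sub_apply, Matrix.smul_apply, smul_eq_mul]
  fun_prop

lemma eq_of_mapClusterPt_of_tendsto {X Y : Type*} [TopologicalSpace X] [TopologicalSpace Y]
    [T2Space Y] {u : ℕ → X} {a : X} (h : MapClusterPt a atTop u) {f : X → Y}
    (hf : ContinuousAt f a) {b : Y} (hb : Tendsto (f ∘ u) atTop (𝓝 b)) : f a = b := by
  have h1 : MapClusterPt (f a) atTop (f ∘ u) := h.continuousAt_comp hf
  have : (𝓝 (f a) ⊓ 𝓝 b).NeBot := NeBot.mono h1 (inf_le_inf_left _ hb)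
  exact eq_of_nhds_neBot this

end Limits

end SGLA

open SGLA in
theorem mainTheorem3 (p k z : ℕ) (P : SGLA.Problem p k z)
    (hβ : 0 < P.β) (hγ : 0 < P.γ) (hc₁ : 0 < P.c₁) (hc : P.c₁ ≤ P.c₂)
    (hconv : Convex ℝ P.Sψ) (hclosed : IsClosed P.Sψ)
    (hord : ∀ e ψ : Fin (p - z) → ℝ, Antitone e → SGLA.IsNearest P.Sψ e ψ →
      Antitone (SGLA.padZeros p z ψ))
    (x : ℕ → SGLA.Var p k z) (hx : ∀ t, P.Iteration (x t) (x (t + 1))) :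
    (∃ C : Set (SGLA.Var p k z), IsCompact C ∧ ∀ t, x t ∈ C) ∧
    (∀ y, MapClusterPt y atTop x → P.IsStationary y ∧ P.IsKKT y ∧
      ∀ (s : ℕ) (a : Fin s → Fin (p - z) → ℝ) (r : Fin s → ℝ),
        P.Sψ = {ψ | ∀ j, a j ⬝ᵥ ψ ≤ r j} → P.IsKKTWith (SGLA.multiplierCone a r y.psi) y) ∧
    Tendsto x atTop (𝓝ˢ {y | P.IsKKT y}) := by
  have hopt : ∀ t, P.BlockOptimal (x (t + 1)) := fun t => (hx t).blockOptimal hβ hc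
  have hfeas : ∀ t, x (t + 1) ∈ P.feasible := fun t => (hopt t).feasible hc
  have hdesc : ∀ t, P.cost (x (t + 1 + 1))
      + P.γ * ∑ e, ((x (t + 1 + 1)).w e - (x (t + 1)).w e) ^ 2 ≤ P.cost (x (t + 1)) := fun t =>
    (hx (t + 1)).cost_le hβ hγ hc₁ hc (hfeas t) ((hx t).antitone_padZeros hord)
  have hstep0 : ∀ t, 0 ≤ P.γ * ∑ e, ((x (t + 1 + 1)).w e - (x (t + 1)).w e) ^ 2 := fun t =>
    mul_nonneg hγ.le (Finset.sum_nonneg fun e _ => sq_nonneg _)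
  have hanti : Antitone fun t => P.cost (x (t + 1)) :=
    antitone_nat_of_succ_le fun t => by linarith [hdesc t, hstep0 t]
  have hcompact : ∃ C : Set (Var p k z), IsCompact C ∧ ∀ t, x t ∈ C := by
    obtain ⟨B, hB⟩ := P.exists_mem_coordBox hβ hγ hc₁ (P.cost (x 1))
    refine ⟨insert (x 0) (coordBox p k z B), (isCompact_coordBox B).insert _, fun t => ?_⟩
    rcases t with _ | t
    · exact Set.mem_insert _ _
    · exact Set.mem_insert_of_mem _ (hB _ (hfeas t) (hanti (Nat.zero_le t)))
  have hbdd : BddBelow (Set.range fun t => P.cost (x (t + 1))) := by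
    obtain ⟨C, hC⟩ := P.exists_penalty_le hβ hc₁
    refine ⟨-C, ?_⟩
    rintro _ ⟨t, rfl⟩
    have h1 := mul_nonneg hβ.le (frobSq_nonneg
      (lapOp (x (t + 1)).w - (x (t + 1)).U * diagonal (x (t + 1)).lam * (x (t + 1)).Uᵀ))
    have h2 := mul_nonneg hγ.le (frobSq_nonneg
      (adjOp (x (t + 1)).w - (x (t + 1)).V * diagonal (x (t + 1)).psi * (x (t + 1)).Vᵀ))
    linarith [hC _ (hfeas t)]
  have hlim := tendsto_atTop_ciInf hanti hbdd
  have hdiff : Tendsto (fun t => (P.cost (x (t + 1)) - P.cost (x (t + 1 + 1))) / P.γ)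
      atTop (𝓝 0) := by
    simpa using (hlim.sub (hlim.comp (tendsto_add_atTop_nat 1))).div_const P.γ
  have hres : ∀ e, Tendsto ((fun y : Var p k z => (P.updateW y e - y.w e) ^ 2) ∘ x)
      atTop (𝓝 0) := by
    intro e
    rw [← tendsto_add_atTop_iff_nat 1]
    refine squeeze_zero (fun t => sq_nonneg _) (fun t => ?_) hdiff
    have h1 := Finset.single_le_sum
      (f := fun e => ((x (t + 1 + 1)).w e - (x (t + 1)).w e) ^ 2)
      (fun _ _ => sq_nonneg _) (Finset.mem_univ e)
    have h2 : (x (t + 1 + 1)).w = P.updateW (x (t + 1)) := (hx (t + 1)).1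
    rw [le_div_iff₀ hγ]
    have h3 := mul_le_mul_of_nonneg_left h1 hγ.le
    rw [h2] at h3
    have h4 := hdesc t
    rw [h2] at h4
    simp only [Function.comp_apply]
    linarith
  have hfix : ∀ y, MapClusterPt y atTop x → P.BlockOptimal y ∧ P.updateW y = y.w := by
    intro y hy
    refine ⟨?_, funext fun e => ?_⟩
    · refine (isClosed_iff_clusterPt.1 (P.isClosed_blockOptimal hclosed)) y (ClusterPt.mono hy ?_)
      refine le_principal_iff.2 (mem_map.2 ?_)
      filter_upwards [eventually_ge_atTop 1] with t ht
      obtain ⟨t, rfl⟩ := Nat.exists_eq_add_of_le' ht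
      exact hopt t
    · have hcont : Continuous fun y : Var p k z => (P.updateW y e - y.w e) ^ 2 :=
        (((continuous_apply e).comp P.continuous_updateW).sub
          ((continuous_apply e).comp continuous_fst)).pow 2
      exact sub_eq_zero.1 (pow_eq_zero_iff two_ne_zero |>.1
        (eq_of_mapClusterPt_of_tendsto hy hcont.continuousAt (hres e)))
  have hlimit : ∀ y, MapClusterPt y atTop x → P.IsKKT y := fun y hy =>
    (hfix y hy).1.isKKTWith hβ hγ hc₁ hc hconv (hfix y hy).2 subset_rfl
  refine ⟨hcompact, fun y hy => ⟨(hlimit y hy).isStationary hc₁ hc, hlimit y hy,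
    fun s a r hS => ?_⟩, fun s hs => ?_⟩
  · obtain ⟨hy1, hy2⟩ := hfix y hy
    exact hy1.isKKTWith hβ hγ hc₁ hc hconv hy2
      (normalCone_subset_multiplierCone a r hS hy1.psi_nearest.1)
  -- a sequence in a compact set that keeps leaving a neighbourhood has a limit point outside
  · obtain ⟨O, hO, hKO, hOs⟩ := mem_nhdsSet_iff_exists.1 hs
    by_contra hcon
    obtain ⟨C, hC, hxC⟩ := hcompact
    have hfreq : ∃ᶠ t in atTop, x t ∈ C \ O := by
      intro hev
      refine hcon (mem_map.2 ?_)
      filter_upwards [hev] with t ht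
      by_contra hts
      exact ht ⟨hxC t, fun h => hts (hOs h)⟩
    obtain ⟨y, hyC, hy⟩ := (hC.diff hO).exists_mapClusterPt_of_frequently hfreq
    exact hyC.2 (hKO (hlimit y hy))
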